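/- Let $k$ be an algebraically closed field of characteristic zero and let $R$ be a local, normal (integrally closed), commutative noetherian domain that is a $k$-algebra. Let $\Gamma$ be a tame $R$-order in $A$ with centre $Z(\Gamma)=R$; that is, $\Gamma$ is a prime ring with centre $R$ and simple artinian ring of fractions $A$, $\Gamma$ is a finitely generated reflexive $R$-module, and $\Gamma_{\mathfrak p}=\Gamma\otimes_R R_{\mathfrak p}$ is hereditary for every height one prime ideal $\mathfrak p$ of $R$. Let $P$ be an $R$-central invertible $\Gamma$-bimodule: the left and right actions of $R$ on $P$ agree, and there is a $\Gamma$-bimodule $Q$ with $P\otimes_\Gamma Q\cong\Gamma\cong Q\otimes_\Gamma P$ as $\Gamma$-bimodules. Then there exists an integer $n>0$ such that $P^{\otimes n}\cong\Gamma$ as $\Gamma$-bimodules, where $P^{\otimes n}$ is the $n$-fold tensor power over $\Gamma$. -/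

import Mathlib

open scoped TensorProduct

universe u v w

section Rings

/-- A prime ring: a nonzero ring in which `a S b = 0` implies `a = 0` or `b = 0`. -/
structure IsPrimeRing (S : Type v) [Ring S] : Prop where
  nontrivial : Nontrivial S
  eq_zero_or_eq_zero : ∀ a b : S, (∀ x : S, a * x * b = 0) → a = 0 ∨ b = 0

/-- A (left and right) hereditary ring: all left ideals and all right ideals are projective. -/
structure IsHereditaryRing (S : Type v) [Ring S] : Prop where
  left : ∀ I : Submodule S S, Module.Projective S I
  right : ∀ I : Submodule Sᵐᵒᵖ S, Module.Projective Sᵐᵒᵖ I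

/-- `ι : S → A` exhibits `A` as the (two-sided, classical) ring of fractions of `S`: the map is
injective, regular elements of `S` become invertible in `A`, and every element of `A` is both a
left fraction `s⁻¹ x` and a right fraction `y t⁻¹` with `s`, `t` regular. -/
structure IsRingOfFractions {S : Type v} {A : Type w} [Ring S] [Ring A] (ι : S →+* A) : Prop where
  injective : Function.Injective ι
  isUnit : ∀ s ∈ nonZeroDivisors S, IsUnit (ι s)
  left_fraction : ∀ a : A, ∃ s ∈ nonZeroDivisors S, ∃ x : S, ι s * a = ι x
  right_fraction : ∀ a : A, ∃ t ∈ nonZeroDivisors S, ∃ y : S, a * ι t = ι y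

/-- `Γ` is a prime `R`-order in `A` (via `ι`): a prime ring, finitely generated as a module over
its central subring `R`, with simple artinian ring of fractions `A`. -/
structure IsPrimeOrder (R : Type u) {Γ : Type v} {A : Type w} [CommRing R] [Ring Γ] [Algebra R Γ]
    [Ring A] (ι : Γ →+* A) : Prop where
  algebraMap_injective : Function.Injective (algebraMap R Γ)
  finite : Module.Finite R Γ
  isPrimeRing : IsPrimeRing Γ
  isSimpleRing : IsSimpleRing A
  isArtinianRing : IsArtinianRing A
  isRingOfFractions : IsRingOfFractions ι

/-- `Γ` is hereditary in codimension one over `R`: for every prime ideal `p` of height one of `R`,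
the ring `Γ_p = Γ ⊗[R] R_p` is hereditary. -/
def IsHereditaryInCodimOne (R : Type u) (Γ : Type v) [CommRing R] [Ring Γ] [Algebra R Γ] : Prop :=
  ∀ (p : Ideal R) [p.IsPrime], p.height = 1 →
    IsHereditaryRing (Γ ⊗[R] Localization.AtPrime p)

/-- `Γ` is a tame `R`-order in `A` (via `ι`): a prime `R`-order in `A` that is a (finitely
generated) reflexive `R`-module and is hereditary in codimension one. -/
structure IsTameOrder (R : Type u) {Γ : Type v} {A : Type w} [CommRing R] [Ring Γ] [Algebra R Γ]
    [Ring A] (ι : Γ →+* A) : Prop extends IsPrimeOrder R ι where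
  isReflexive : Module.IsReflexive R Γ
  hereditary : IsHereditaryInCodimOne R Γ

end Rings

section Balanced

variable (S : Type v) [Ring S] (M N : Type v) [AddCommGroup M] [AddCommGroup N]
  [Module Sᵐᵒᵖ M] [Module S N]

/-- The subgroup of `M ⊗[ℤ] N` generated by the elements `m s ⊗ n - m ⊗ s n`, where `M` is a
right and `N` a left `S`-module. -/
def balancedRel : AddSubgroup (M ⊗[ℤ] N) :=
  AddSubgroup.closure {t | ∃ (m : M) (s : S) (n : N),
    t = (MulOpposite.op s • m) ⊗ₜ[ℤ] n - m ⊗ₜ[ℤ] (s • n)}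

/-- The tensor product `M ⊗_S N` of a right `S`-module `M` and a left `S`-module `N`, for a not
necessarily commutative ring `S`. -/
def BalancedTensor : Type v := (M ⊗[ℤ] N) ⧸ balancedRel S M N

instance : AddCommGroup (BalancedTensor S M N) :=
  inferInstanceAs (AddCommGroup ((M ⊗[ℤ] N) ⧸ balancedRel S M N))

namespace BalancedTensor

variable {M N}

/-- The quotient map `M ⊗[ℤ] N → M ⊗_S N`. -/
def mk : M ⊗[ℤ] N →+ BalancedTensor S M N :=
  QuotientAddGroup.mk' (balancedRel S M N)

theorem mk_surjective : Function.Surjective (mk S : M ⊗[ℤ] N →+ BalancedTensor S M N) :=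
  QuotientAddGroup.mk'_surjective (balancedRel S M N)

theorem mk_eq_zero {t : M ⊗[ℤ] N} : mk S t = 0 ↔ t ∈ balancedRel S M N :=
  QuotientAddGroup.eq_zero_iff t

/-- The class of `m ⊗ n` in `M ⊗_S N`. -/
def tmul (m : M) (n : N) : BalancedTensor S M N :=
  mk S (m ⊗ₜ[ℤ] n)

/-- Additive endomorphisms `f` of the right module `M` and `g` of the left module `N` that commute
with the action of `S` induce an endomorphism `f ⊗ g` of `M ⊗_S N`. -/
def mapEnd (f : M →ₗ[ℤ] M) (g : N →ₗ[ℤ] N)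
    (hf : ∀ (s : S) (m : M), f (MulOpposite.op s • m) = MulOpposite.op s • f m)
    (hg : ∀ (s : S) (n : N), g (s • n) = s • g n) :
    BalancedTensor S M N →+ BalancedTensor S M N :=
  QuotientAddGroup.map (balancedRel S M N) (balancedRel S M N)
    (TensorProduct.map f g).toAddMonoidHom (by
      rw [balancedRel, AddSubgroup.closure_le]
      rintro _ ⟨m, s, n, rfl⟩
      refine AddSubgroup.subset_closure ⟨f m, s, g n, ?_⟩
      rw [map_sub, LinearMap.toAddMonoidHom_coe, TensorProduct.map_tmul, TensorProduct.map_tmul,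
        hf, hg])

theorem mapEnd_tmul (f : M →ₗ[ℤ] M) (g : N →ₗ[ℤ] N)
    (hf : ∀ (s : S) (m : M), f (MulOpposite.op s • m) = MulOpposite.op s • f m)
    (hg : ∀ (s : S) (n : N), g (s • n) = s • g n) (m : M) (n : N) :
    mapEnd S f g hf hg (tmul S m n) = tmul S (f m) (g n) := rfl

theorem add_tmul (m m' : M) (n : N) : tmul S (m + m') n = tmul S m n + tmul S m' n := by
  rw [tmul, TensorProduct.add_tmul, map_add]; rfl

theorem tmul_add (m : M) (n n' : N) : tmul S m (n + n') = tmul S m n + tmul S m n' := by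
  rw [tmul, TensorProduct.tmul_add, map_add]; rfl

theorem zero_tmul (n : N) : tmul S (0 : M) n = 0 := by
  rw [tmul, TensorProduct.zero_tmul, map_zero]

theorem tmul_zero (m : M) : tmul S m (0 : N) = 0 := by
  rw [tmul, TensorProduct.tmul_zero, map_zero]

theorem smul_tmul (m : M) (s : S) (n : N) :
    tmul S (MulOpposite.op s • m) n = tmul S m (s • n) := by
  rw [← sub_eq_zero, tmul, tmul, ← map_sub, mk_eq_zero]
  exact AddSubgroup.subset_closure ⟨m, s, n, rfl⟩

variable {S}

theorem induction_on {C : BalancedTensor S M N → Prop} (t : BalancedTensor S M N)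
    (zero : C 0) (tmul : ∀ m n, C (tmul S m n)) (add : ∀ x y, C x → C y → C (x + y)) : C t := by
  obtain ⟨t, rfl⟩ := mk_surjective S t
  induction t using TensorProduct.induction_on with
  | zero => rw [map_zero]; exact zero
  | tmul m n => exact tmul m n
  | add x y hx hy => rw [map_add]; exact add _ _ hx hy

/-- The left action on `M ⊗_S N`: `s (m ⊗ n) = s m ⊗ n`. -/
instance leftModule [Module S M] [SMulCommClass S Sᵐᵒᵖ M] :
    Module S (BalancedTensor S M N) where
  smul s t := BalancedTensor.mapEnd S (DistribSMul.toAddMonoidHom M s).toIntLinearMap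
    LinearMap.id (fun r m => smul_comm s (MulOpposite.op r) m) (fun _ _ => rfl) t
  one_smul t := by
    induction t using BalancedTensor.induction_on with
    | zero => exact map_zero _
    | tmul m n => exact congrArg (BalancedTensor.tmul S · n) (one_smul S m)
    | add x y hx hy => exact (map_add _ x y).trans (congrArg₂ (· + ·) hx hy)
  mul_smul r s t := by
    induction t using BalancedTensor.induction_on with
    | zero => exact (map_zero _).trans ((congrArg _ (map_zero _)).trans (map_zero _)).symm
    | tmul m n => exact congrArg (BalancedTensor.tmul S · n) (mul_smul r s m)
    | add x y hx hy =>
      exact (map_add _ x y).trans ((congrArg₂ (· + ·) hx hy).trans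
        ((congrArg _ (map_add _ x y)).trans (map_add _ _ _)).symm)
  smul_zero s := map_zero _
  smul_add s x y := map_add _ x y
  add_smul r s t := by
    induction t using BalancedTensor.induction_on with
    | zero =>
      exact (map_zero _).trans ((congrArg₂ (· + ·) (map_zero _) (map_zero _)).trans
        (add_zero _)).symm
    | tmul m n =>
      exact (congrArg (BalancedTensor.tmul S · n) (add_smul r s m)).trans
        (BalancedTensor.add_tmul S _ _ n)
    | add x y hx hy =>
      exact (map_add _ x y).trans ((congrArg₂ (· + ·) hx hy).trans
        ((add_add_add_comm _ _ _ _).trans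
          (congrArg₂ (· + ·) (map_add _ x y).symm (map_add _ x y).symm)))
  zero_smul t := by
    induction t using BalancedTensor.induction_on with
    | zero => exact map_zero _
    | tmul m n =>
      exact (congrArg (BalancedTensor.tmul S · n) (zero_smul S m)).trans
        (BalancedTensor.zero_tmul S n)
    | add x y hx hy =>
      exact (map_add _ x y).trans ((congrArg₂ (· + ·) hx hy).trans (add_zero _))

/-- The right action on `M ⊗_S N`: `(m ⊗ n) s = m ⊗ n s`. -/
instance rightModule [Module Sᵐᵒᵖ N] [SMulCommClass S Sᵐᵒᵖ N] :
    Module Sᵐᵒᵖ (BalancedTensor S M N) where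
  smul s t := BalancedTensor.mapEnd S LinearMap.id
    (DistribSMul.toAddMonoidHom N s).toIntLinearMap
    (fun _ _ => rfl) (fun r n => (smul_comm r s n).symm) t
  one_smul t := by
    induction t using BalancedTensor.induction_on with
    | zero => exact map_zero _
    | tmul m n => exact congrArg (BalancedTensor.tmul S m ·) (one_smul Sᵐᵒᵖ n)
    | add x y hx hy => exact (map_add _ x y).trans (congrArg₂ (· + ·) hx hy)
  mul_smul r s t := by
    induction t using BalancedTensor.induction_on with
    | zero => exact (map_zero _).trans ((congrArg _ (map_zero _)).trans (map_zero _)).symm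
    | tmul m n => exact congrArg (BalancedTensor.tmul S m ·) (mul_smul r s n)
    | add x y hx hy =>
      exact (map_add _ x y).trans ((congrArg₂ (· + ·) hx hy).trans
        ((congrArg _ (map_add _ x y)).trans (map_add _ _ _)).symm)
  smul_zero s := map_zero _
  smul_add s x y := map_add _ x y
  add_smul r s t := by
    induction t using BalancedTensor.induction_on with
    | zero =>
      exact (map_zero _).trans ((congrArg₂ (· + ·) (map_zero _) (map_zero _)).trans
        (add_zero _)).symm
    | tmul m n =>
      exact (congrArg (BalancedTensor.tmul S m ·) (add_smul r s n)).trans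
        (BalancedTensor.tmul_add S m _ _)
    | add x y hx hy =>
      exact (map_add _ x y).trans ((congrArg₂ (· + ·) hx hy).trans
        ((add_add_add_comm _ _ _ _).trans
          (congrArg₂ (· + ·) (map_add _ x y).symm (map_add _ x y).symm)))
  zero_smul t := by
    induction t using BalancedTensor.induction_on with
    | zero => exact map_zero _
    | tmul m n =>
      exact (congrArg (BalancedTensor.tmul S m ·) (zero_smul Sᵐᵒᵖ n)).trans
        (BalancedTensor.tmul_zero S m)
    | add x y hx hy =>
      exact (map_add _ x y).trans ((congrArg₂ (· + ·) hx hy).trans (add_zero _))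

theorem left_smul_tmul [Module S M] [SMulCommClass S Sᵐᵒᵖ M] (s : S) (m : M) (n : N) :
    s • tmul S m n = tmul S (s • m) n := rfl

theorem right_smul_tmul [Module Sᵐᵒᵖ N] [SMulCommClass S Sᵐᵒᵖ N] (s : S) (m : M) (n : N) :
    MulOpposite.op s • tmul S m n = tmul S m (MulOpposite.op s • n) := rfl

instance smulCommClass [Module S M] [SMulCommClass S Sᵐᵒᵖ M] [Module Sᵐᵒᵖ N]
    [SMulCommClass S Sᵐᵒᵖ N] : SMulCommClass S Sᵐᵒᵖ (BalancedTensor S M N) where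
  smul_comm r s t := by
    induction t using BalancedTensor.induction_on with
    | zero => simp only [smul_zero]
    | tmul m n => rfl
    | add x y hx hy => simp only [smul_add, hx, hy]

end BalancedTensor

end Balanced

/-- An `S`-bimodule: an abelian group with commuting left and right actions of the ring `S`, the
right action being written as a left action of the opposite ring, `m s = op s • m`. -/
structure Bimodule (S : Type v) [Ring S] where
  carrier : Type v
  [addCommGroup : AddCommGroup carrier]
  [leftModule : Module S carrier]
  [rightModule : Module Sᵐᵒᵖ carrier]
  [smulCommClass : SMulCommClass S Sᵐᵒᵖ carrier]

namespace Bimodule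

attribute [instance] addCommGroup leftModule rightModule smulCommClass

variable {S : Type v} [Ring S]

/-- The ring `S` as a bimodule over itself. -/
abbrev regular (S : Type v) [Ring S] : Bimodule S where
  carrier := S

/-- Two bimodules are isomorphic: there is a bijective additive map that is linear for the left
and for the right action. -/
def Isomorphic (M N : Bimodule S) : Prop :=
  ∃ e : M.carrier ≃+ N.carrier, (∀ (s : S) (m : M.carrier), e (s • m) = s • e m) ∧
    ∀ (s : S) (m : M.carrier), e (MulOpposite.op s • m) = MulOpposite.op s • e m

/-- The tensor product of bimodules `M ⊗_S N`, with `s (m ⊗ n) s' = s m ⊗ n s'`. -/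
abbrev tensor (M N : Bimodule S) : Bimodule S where
  carrier := BalancedTensor S M.carrier N.carrier

/-- The tensor powers `P^{⊗ n}` over `S`: `P^{⊗ 0} = S` and `P^{⊗ (n+1)} = P^{⊗ n} ⊗_S P`. -/
def tensorPow (P : Bimodule S) : ℕ → Bimodule S
  | 0 => regular S
  | n + 1 => (tensorPow P n).tensor P

/-- An invertible bimodule: some bimodule is a two-sided inverse of it with respect to `⊗_S`, up to
isomorphism of bimodules. -/
def IsInvertible (P : Bimodule S) : Prop :=
  ∃ Q : Bimodule S, (P.tensor Q).Isomorphic (regular S) ∧ (Q.tensor P).Isomorphic (regular S)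

/-- The bimodule `P` over the `R`-algebra `S` is `R`-central: the left and the right action of `R`
agree. -/
def IsCentralOver (R : Type u) [CommRing R] [Algebra R S] (P : Bimodule S) : Prop :=
  ∀ (r : R) (x : P.carrier), algebraMap R S r • x = MulOpposite.op (algebraMap R S r) • x

end Bimodule

/-! Let K be the fraction field of `R` and D = K ⊗ Γ, a central simple K-algebra of finite dimension
d. Its enveloping algebra acts as all of End_K(D), so every nonzero torsion-free central bimodule
contains a nonzero element centralizing `Γ`. Such elements in `P` and in its inverse turn the two
bimodules into mutually inverse fractional ideals I and J in D
(`Bimodule.exists_isEmbedding_isInversePair`), and tensor powers of `P` into powers of I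
(`Bimodule.IsEmbedding.tensorPow`). It remains to find a power of I of the form Γz with z a nonzero
scalar of K.

As `R` is local, `Γ` has finitely many simple modules, and the tops of the powers of I have bounded
length. Two powers therefore have isomorphic tops; since I is invertible, hence projective, the
isomorphism lifts to right multiplication by an element, and some power of I is Γu
(`exists_pow_eq_order_mul_span`). Here u is a unit of D normalizing `Γ`. With N the norm of the
regular representation, w = u^d N(u)⁻¹ still normalizes `Γ` and has norm one. If w and w⁻¹ lie in
`Γ`, then Γu^d = ΓN(u), as wanted.

That a normalizing element of norm one lies in `Γ` (`IsTameOrder.mem_range_of_normalizing`) may be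
checked at the primes of height one, because `Γ` is reflexive. There the base is a discrete
valuation ring, and the invertible ideal wΓ_p is comparable with Γ_p (`le_or_le_of_invertible`). So
w or w⁻¹ lies in Γ_p, and an element of Γ_p of norm one is a unit of Γ_p.

Comparability is where heredity enters: the sum of an invertible ideal and the order is again
invertible, which reduces the claim to two comaximal integral invertible ideals. Each is either the
whole order or has a power inside π times the order (`exists_pow_le_of_invertible`), and two ideals
of the second kind cannot be comaximal. The dichotomy holds because a failure would give an
idempotent that is central modulo a high power of π; by Artin–Rees it would be a scalar modulo π,
and the scalars form a local ring. -/

/-! ### Inverse pairs in a monoid -/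

/-- `I` and `J` are mutually inverse elements of the corner monoid of the idempotent `E`. -/
structure IsInversePair {S : Type*} [Mul S] (E I J : S) : Prop where
  left_mul : E * I = I
  mul_right : I * E = I
  left_mul' : E * J = J
  mul_right' : J * E = J
  mul_inv : I * J = E
  inv_mul : J * I = E

namespace IsInversePair

variable {S : Type*} [Monoid S] {E I J I' J' : S}

theorem symm (h : IsInversePair E I J) : IsInversePair E J I :=
  ⟨h.left_mul', h.mul_right', h.left_mul, h.mul_right, h.inv_mul, h.mul_inv⟩

theorem mul (h : IsInversePair E I J) (h' : IsInversePair E I' J') :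
    IsInversePair E (I * I') (J' * J) where
  left_mul := by rw [← mul_assoc, h.left_mul]
  mul_right := by rw [mul_assoc, h'.mul_right]
  left_mul' := by rw [← mul_assoc, h'.left_mul']
  mul_right' := by rw [mul_assoc, h.mul_right']
  mul_inv := by rw [mul_assoc, ← mul_assoc I', h'.mul_inv, ← mul_assoc, h.mul_right, h.mul_inv]
  inv_mul := by rw [mul_assoc, ← mul_assoc J, h.inv_mul, ← mul_assoc, h'.mul_right', h'.inv_mul]

theorem pow (h : IsInversePair E I J) (n : ℕ) : IsInversePair E (I ^ (n + 1)) (J ^ (n + 1)) := by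
  induction n with
  | zero => simpa using h
  | succ n ih => rw [pow_succ, pow_succ' J]; exact ih.mul h

theorem central_mul (h : IsInversePair E I J) {c d : S} (hc : ∀ x, c * x = x * c)
    (hd : ∀ x, d * x = x * d) (hcd : c * d = 1) : IsInversePair E (c * I) (d * J) where
  left_mul := by rw [← mul_assoc, ← hc E, mul_assoc, h.left_mul]
  mul_right := by rw [mul_assoc, h.mul_right]
  left_mul' := by rw [← mul_assoc, ← hd E, mul_assoc, h.left_mul']
  mul_right' := by rw [mul_assoc, h.mul_right']
  mul_inv := by rw [hd J, mul_assoc, ← mul_assoc I, h.mul_inv, ← hd, ← mul_assoc, hcd, one_mul]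
  inv_mul := by
    rw [hc I, mul_assoc, ← mul_assoc J, h.inv_mul, ← hc, ← mul_assoc, ← hc d, hcd, one_mul]

theorem inv_unique (h : IsInversePair E I J) (h' : IsInversePair E I J') : J = J' := by
  rw [← h.mul_right', ← h'.mul_inv, ← mul_assoc, h.inv_mul, h'.left_mul']

end IsInversePair

/-! ### Invertible lattices of an order -/

section Lattices

variable {O : Type*} {A : Type*} [CommRing O] [Ring A] [Algebra O A]

theorem span_singleton_central {z : A} (hz : ∀ x, z * x = x * z) (M : Submodule O A) :
    Submodule.span O {z} * M = M * Submodule.span O {z} := by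
  apply le_antisymm
  · rw [Submodule.mul_le]
    intro m hm n hn
    obtain ⟨c, rfl⟩ := Submodule.mem_span_singleton.1 hm
    rw [smul_mul_assoc, hz, ← mul_smul_comm]
    exact Submodule.mul_mem_mul hn hm
  · rw [Submodule.mul_le]
    intro m hm n hn
    obtain ⟨c, rfl⟩ := Submodule.mem_span_singleton.1 hn
    rw [mul_smul_comm, ← hz, ← smul_mul_assoc]
    exact Submodule.mul_mem_mul hn hm

variable (G : Subalgebra O A)

local notation "E" => Subalgebra.toSubmodule G

theorem one_le_order : (1 : Submodule O A) ≤ E := by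
  rw [Submodule.one_le]; exact G.one_mem

theorem order_mul_order : E * E = E := Subalgebra.isIdempotentElem_toSubmodule G

/-- Every two-sided `G`-lattice containing `G` is projective as a left and as a right module, in
the form of the dual basis lemma. -/
def HasDualBases : Prop :=
  ∀ M : Submodule O A, E * M = M → M * E = M → E ≤ M → M.FG →
    (∃ N, N * M ≤ E ∧ E ≤ M * N) ∧ ∃ N, M * N ≤ E ∧ E ≤ N * M

variable {G}

/-- Write 1 ∈ J * I as a finite sum of products. The factors from `I` that occur generate `I` over
the order. -/
theorem IsInversePair.fg (hG : (E).FG) {I J : Submodule O A} (h : IsInversePair E I J) :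
    I.FG := by
  have h1 : (1 : A) ∈ J * I := by rw [h.inv_mul]; exact G.one_mem
  obtain ⟨T, T', hT, hT', h1⟩ := Submodule.mem_span_mul_finite_of_mem_mul h1
  have key : I = E * Submodule.span O (T' : Set A) := by
    apply le_antisymm
    · intro x hx
      have : x * 1 ∈ I * (J * Submodule.span O (T' : Set A)) := by
        refine Submodule.mul_mem_mul hx ?_
        rw [← Submodule.span_mul_span] at h1
        exact mul_le_mul' (Submodule.span_le.2 hT) le_rfl h1
      rwa [mul_one, ← mul_assoc, h.mul_inv] at this
    · calc _ ≤ E * I := mul_le_mul' le_rfl (Submodule.span_le.2 hT')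
        _ = I := h.left_mul
  rw [key]
  exact hG.mul (Submodule.fg_span T'.finite_toSet)

/-- The dual bases provide `N` and `N'` with half of the inclusions. For the others: N I ≤ E forces
N ≤ J, and N E ≤ E forces N ≤ E, whence (I + E) N ≤ I J + E = E; symmetrically for `N'`. -/
theorem IsInversePair.sup_order (hG : (E).FG) (hd : HasDualBases G) {I J : Submodule O A}
    (h : IsInversePair E I J) : ∃ N, IsInversePair E (I ⊔ E) N := by
  have hEE := order_mul_order G
  have hl : E * (I ⊔ E) = I ⊔ E := by rw [Submodule.mul_sup, h.left_mul, hEE]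
  have hr : (I ⊔ E) * E = I ⊔ E := by rw [Submodule.sup_mul, h.mul_right, hEE]
  have h1 := one_le_order G
  obtain ⟨⟨N, hN, hN'⟩, N', hM, hM'⟩ := hd (I ⊔ E) hl hr le_sup_right ((h.fg hG).sup hG)
  have hMN : (I ⊔ E) * N = E := by
    refine le_antisymm ?_ hN'
    have e1 : N * I ≤ E := (mul_le_mul' le_rfl le_sup_left).trans hN
    have e2 : N * E ≤ E := (mul_le_mul' le_rfl le_sup_right).trans hN
    have e3 : N ≤ E := by
      calc N = N * 1 := (mul_one N).symm
        _ ≤ N * E := mul_le_mul' le_rfl h1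
        _ ≤ E := e2
    have e4 : N ≤ J := by
      calc N = N * 1 := (mul_one N).symm
        _ ≤ N * (I * J) := mul_le_mul' le_rfl (h.mul_inv ▸ h1)
        _ = N * I * J := (mul_assoc _ _ _).symm
        _ ≤ E * J := mul_le_mul' e1 le_rfl
        _ = J := h.left_mul'
    rw [Submodule.sup_mul]
    refine sup_le ?_ ?_
    · exact (mul_le_mul' le_rfl e4).trans h.mul_inv.le
    · exact (mul_le_mul' le_rfl e3).trans hEE.le
  have hNM : N' * (I ⊔ E) = E := by
    refine le_antisymm ?_ hM'
    have e1 : I * N' ≤ E := (mul_le_mul' le_sup_left le_rfl).trans hM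
    have e2 : E * N' ≤ E := (mul_le_mul' le_sup_right le_rfl).trans hM
    have e3 : N' ≤ E := by
      calc N' = 1 * N' := (one_mul N').symm
        _ ≤ E * N' := mul_le_mul' h1 le_rfl
        _ ≤ E := e2
    have e4 : N' ≤ J := by
      calc N' = 1 * N' := (one_mul N').symm
        _ ≤ (J * I) * N' := mul_le_mul' (h.inv_mul ▸ h1) le_rfl
        _ = J * (I * N') := (mul_assoc _ _ _)
        _ ≤ J * E := mul_le_mul' le_rfl e1
        _ = J := h.mul_right'
    rw [Submodule.mul_sup]
    refine sup_le ?_ ?_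
    · exact (mul_le_mul' e4 le_rfl).trans h.inv_mul.le
    · exact (mul_le_mul' e3 le_rfl).trans hEE.le
  -- `N` is not known to be stable under the order, so its two-sided saturation serves as the
  -- inverse. The left inverse `N'` shows that it inverts on both sides.
  refine ⟨E * N * E, hl, hr, ?_, ?_, ?_, ?_⟩
  · rw [← mul_assoc, ← mul_assoc, hEE]
  · rw [mul_assoc, hEE]
  · rw [← mul_assoc, ← mul_assoc, hr, hMN, hEE]
  · rw [mul_assoc, hl]
    calc E * N * (I ⊔ E) = N' * (I ⊔ E) * N * (I ⊔ E) := by rw [hNM]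
      _ = E := by rw [mul_assoc N', hMN, mul_assoc, hl, hNM]

theorem comaximal_pow_left {B C : Submodule O A} (hC : E * C = C)
    (hC' : C * E = C) (hBC : B ⊔ C = E) (n : ℕ) : B ^ (n + 1) ⊔ C = E := by
  have hBE : B ≤ E := hBC ▸ le_sup_left
  have hCE : C ≤ E := hBC ▸ le_sup_right
  have hp (n : ℕ) : B ^ (n + 1) ≤ E := by
    induction n with
    | zero => simpa using hBE
    | succ n ih =>
      rw [pow_succ]
      exact (mul_le_mul' ih hBE).trans (order_mul_order G).le
  induction n with
  | zero => simpa using hBC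
  | succ n ih =>
    refine le_antisymm (sup_le (hp _) hCE) ?_
    calc E = (B ^ (n + 1) ⊔ C) * (B ⊔ C) := by rw [ih, hBC, order_mul_order]
      _ ≤ B ^ (n + 1 + 1) ⊔ C := by
        rw [Submodule.sup_mul, Submodule.mul_sup, Submodule.mul_sup]
        refine sup_le (sup_le ?_ ?_) (sup_le ?_ ?_)
        · exact (pow_succ B (n + 1)).symm.le.trans le_sup_left
        · exact ((mul_le_mul' (hp n) le_rfl).trans hC.le).trans le_sup_right
        · exact ((mul_le_mul' le_rfl hBE).trans hC'.le).trans le_sup_right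
        · exact ((mul_le_mul' le_rfl hCE).trans hC'.le).trans le_sup_right

theorem comaximal_pow_pow {B C : Submodule O A} (hB : E * B = B) (hB' : B * E = B)
    (hC : E * C = C) (hC' : C * E = C) (hBC : B ⊔ C = E) (n m : ℕ) :
    B ^ (n + 1) ⊔ C ^ (m + 1) = E := by
  have h1 := comaximal_pow_left hC hC' hBC n
  have h2 : E * B ^ (n + 1) = B ^ (n + 1) := by rw [pow_succ', ← mul_assoc, hB]
  have h3 : B ^ (n + 1) * E = B ^ (n + 1) := by rw [pow_succ, mul_assoc, hB']
  rw [sup_comm] at h1 ⊢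
  exact comaximal_pow_left h2 h3 h1 m

end Lattices

/-! ### Invertible ideals over a local base with principal maximal ideal -/

section Local

variable {O : Type*} {A : Type*} [CommRing O] [Ring A] [Algebra O A] {G : Subalgebra O A}

local notation "E" => Subalgebra.toSubmodule G

theorem span_algebraMap_central (r : O) (M : Submodule O A) :
    Submodule.span O {algebraMap O A r} * M = M * Submodule.span O {algebraMap O A r} :=
  span_singleton_central (Algebra.commutes r) M

theorem mem_span_algebraMap_mul {r : O} {M : Submodule O A} {x : A} :
    x ∈ Submodule.span O {algebraMap O A r} * M ↔ ∃ y ∈ M, x = r • y := by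
  rw [Submodule.mem_span_singleton_mul]
  simp only [← Algebra.smul_def, eq_comm]

theorem eq_order_of_one_mem {M : Submodule O A} (hM : E * M = M) (hME : M ≤ E) (h1 : (1 : A) ∈ M) :
    M = E := by
  refine le_antisymm hME ?_
  calc E = E * 1 := (mul_one _).symm
    _ ≤ E * M := mul_le_mul' le_rfl (Submodule.one_le.2 h1)
    _ = M := hM

/-- Each innermost product `F * C` is a central multiple of the order and can be pulled out. -/
theorem pow_mul_pow_eq_of_commute {F C : Submodule O A} {π : O} (hF : F * E = F)
    (hFC : F * C = Submodule.span O {algebraMap O A π} * E) (n : ℕ) :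
    F ^ (n + 1) * C ^ (n + 1) = Submodule.span O {algebraMap O A (π ^ (n + 1))} * E := by
  induction n with
  | zero => simpa using hFC
  | succ n ih =>
    have h3 : F ^ (n + 1) * E = F ^ (n + 1) := by rw [pow_succ, mul_assoc, hF]
    calc F ^ (n + 1 + 1) * C ^ (n + 1 + 1)
        = F ^ (n + 1) * (F * C) * C ^ (n + 1) := by
          rw [pow_succ F, pow_succ' C]; simp only [mul_assoc]
      _ = Submodule.span O {algebraMap O A π} * (F ^ (n + 1) * E * C ^ (n + 1)) := by
          rw [hFC, ← mul_assoc, ← span_algebraMap_central]; simp only [mul_assoc]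
      _ = _ := by
          rw [h3, ih, ← mul_assoc, Submodule.span_mul_span, Set.singleton_mul_singleton, ← map_mul,
            ← pow_succ']

/-- If the commutators of `ε` with `G` are highly divisible by `π`, then `ε` is central
modulo `π`. -/
theorem exists_central_approx [IsNoetherianRing O] (π : O) (hG : (E).FG)
    (hcen : ∀ x ∈ G, (∀ y ∈ G, x * y = y * x) → ∃ r, x = algebraMap O A r) :
    ∃ n : ℕ, ∀ ε ∈ G, (∀ g ∈ G, ∃ g' ∈ G, ε * g - g * ε = π ^ (n + 1) • g') →
      ∃ r : O, ∃ y ∈ G, ε = algebraMap O A r + π • y := by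
  have : Module.Finite O G := Module.Finite.iff_fg.2 hG
  obtain ⟨s, hs⟩ := (Module.finite_def.1 this)
  -- The commutators with a finite generating set; the kernel of `D` is the centre of `G`.
  let D : G →ₗ[O] (s → G) := LinearMap.pi fun i =>
    LinearMap.mulRight O (i : G) - LinearMap.mulLeft O (i : G)
  -- Artin–Rees for the range of `D`: a commutator vector divisible by π^(k+1) is `D` of an element
  -- of π `G`. Subtracting that element from `ε` leaves a central one.
  obtain ⟨k, hk⟩ := Ideal.exists_pow_inf_eq_pow_smul (Ideal.span {π}) (LinearMap.range D)
  refine ⟨k, fun ε hε h => ?_⟩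
  choose g' hg' hg using h
  have h1 : D ⟨ε, hε⟩ ∈ (Ideal.span {π}) ^ (k + 1) • (⊤ : Submodule O (s → G)) ⊓
      LinearMap.range D := by
    refine ⟨?_, _, rfl⟩
    have : D ⟨ε, hε⟩ = π ^ (k + 1) • fun i : s => (⟨g' i.1 i.1.2, hg' i.1 i.1.2⟩ : G) := by
      funext i
      apply Subtype.ext
      exact hg i.1 i.1.2
    rw [this]
    exact Submodule.smul_mem_smul (Ideal.pow_mem_pow (Ideal.mem_span_singleton_self π) _) trivial
  rw [hk (k + 1) (Nat.le_succ k), Nat.add_sub_cancel_left, pow_one] at h1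
  have h2 := Submodule.smul_mono (le_refl (Ideal.span {π})) (inf_le_right :
    (Ideal.span {π}) ^ k • (⊤ : Submodule O (s → G)) ⊓ LinearMap.range D ≤ _) h1
  rw [LinearMap.range_eq_map, ← Submodule.map_smul''] at h2
  obtain ⟨y, hy, hDy⟩ := h2
  rw [SetLike.mem_coe, Submodule.ideal_span_singleton_smul,
    Submodule.mem_smul_pointwise_iff_exists] at hy
  obtain ⟨y, -, rfl⟩ := hy
  have hz : ∀ g : G, (⟨ε, hε⟩ - π • y) * g = g * (⟨ε, hε⟩ - π • y) := by
    intro g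
    have hgs : g ∈ Submodule.span O (s : Set G) := by rw [hs]; trivial
    induction hgs using Submodule.span_induction with
    | mem x hx =>
      have := congrFun (sub_eq_zero.2 hDy) ⟨x, hx⟩
      rw [← map_sub] at this
      have h4 : (π • y - ⟨ε, hε⟩) * x - x * (π • y - ⟨ε, hε⟩) = 0 := this
      rw [← neg_sub (π • y), neg_mul, mul_neg, sub_eq_zero.1 h4]
    | zero => simp
    | add a b _ _ ha hb => rw [mul_add, add_mul, ha, hb]
    | smul c a _ ha => rw [mul_smul_comm, smul_mul_assoc, ha]
  obtain ⟨r, hr⟩ := hcen (⟨ε, hε⟩ - π • y : G) (Subtype.prop _)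
    fun g hg => congrArg Subtype.val (hz ⟨g, hg⟩)
  refine ⟨r, y, y.2, ?_⟩
  rw [← hr]
  simp

variable [IsNoetherianRing O] [IsLocalRing O] {π : O}

/-- Write 1 = ε + c with `ε` and `c` in high powers of `F` and `C`. Modulo a power of π this is a
decomposition by central idempotents, so `ε` is a scalar modulo π, and a scalar is a unit or
divisible by π. -/
theorem eq_order_or_eq_order_of_comaximal (hπ : IsLocalRing.maximalIdeal O = Ideal.span {π})
    (hG : (E).FG) (hcen : ∀ x ∈ G, (∀ y ∈ G, x * y = y * x) → ∃ r, x = algebraMap O A r)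
    {F C : Submodule O A} (hF : E * F = F) (hF' : F * E = F) (hC : E * C = C) (hC' : C * E = C)
    (h : F ⊔ C = E) (hFC : F * C = Submodule.span O {algebraMap O A π} * E)
    (hCF : C * F = Submodule.span O {algebraMap O A π} * E) : F = E ∨ C = E := by
  obtain ⟨n, hn⟩ := exists_central_approx π hG hcen
  have hFE : F ≤ E := h ▸ le_sup_left
  have hCE : C ≤ E := h ▸ le_sup_right
  have hp {B : Submodule O A} (hB : E * B = B) (hBE : B ≤ E) : B ^ (n + 1) ≤ B := by
    clear hn
    induction n with
    | zero => simp
    | succ n ih =>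
      rw [pow_succ]
      exact (mul_le_mul' (ih.trans hBE) le_rfl).trans hB.le
  have hl {B : Submodule O A} (hB : E * B = B) {g x : A} (hg : g ∈ G) (hx : x ∈ B ^ (n + 1)) :
      g * x ∈ B ^ (n + 1) := by
    have := Submodule.mul_mem_mul (M := E) hg hx
    rwa [pow_succ', ← mul_assoc, hB, ← pow_succ'] at this
  have hr {B : Submodule O A} (hB : B * E = B) {g x : A} (hg : g ∈ G) (hx : x ∈ B ^ (n + 1)) :
      x * g ∈ B ^ (n + 1) := by
    have := Submodule.mul_mem_mul (N := E) hx hg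
    rwa [pow_succ, mul_assoc, hB, ← pow_succ] at this
  have h1 : (1 : A) ∈ F ^ (n + 1) ⊔ C ^ (n + 1) := by
    rw [comaximal_pow_pow hF hF' hC hC' h]; exact G.one_mem
  obtain ⟨ε, hε, c, hc, hεc⟩ := Submodule.mem_sup.1 h1
  have hεG : ε ∈ G := hFE (hp hF hFE hε)
  obtain ⟨r, y, hy, hr'⟩ := hn ε hεG fun g hg => by
    have hx1 : ε * g - g * ε ∈ F ^ (n + 1) := sub_mem (hr hF' hg hε) (hl hF hg hε)
    have hx2 : ε * g - g * ε ∈ C ^ (n + 1) := by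
      have : ε * g - g * ε = g * c - c * g := by
        rw [← eq_sub_iff_add_eq'] at hεc
        rw [hεc]; noncomm_ring
      rw [this]
      exact sub_mem (hl hC hg hc) (hr hC' hg hc)
    -- The commutator lies in both F^(n+1) and C^(n+1). Multiplying it by 1 = ε + c puts it in
    -- C^(n+1) F^(n+1) + F^(n+1) C^(n+1), and both terms are π^(n+1) E.
    have hx3 : ε * g - g * ε ∈ Submodule.span O {algebraMap O A (π ^ (n + 1))} * E := by
      rw [← mul_one (ε * g - g * ε), ← hεc, mul_add]
      refine add_mem ?_ ?_
      · rw [← pow_mul_pow_eq_of_commute hC' hCF]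
        exact Submodule.mul_mem_mul hx2 hε
      · rw [← pow_mul_pow_eq_of_commute hF' hFC]
        exact Submodule.mul_mem_mul hx1 hc
    exact mem_span_algebraMap_mul.1 hx3
  have hπF : Submodule.span O {algebraMap O A π} * E ≤ F := by
    rw [← hFC]; exact (mul_le_mul' le_rfl hCE).trans hF'.le
  have hπC : Submodule.span O {algebraMap O A π} * E ≤ C := by
    rw [← hCF]; exact (mul_le_mul' le_rfl hFE).trans hC'.le
  -- If `r` is a unit, then r = ε - πy puts a unit in `F`. Otherwise ε ∈ πE ≤ C, and 1 = ε + c lies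
  -- in `C`.
  by_cases hru : IsUnit r
  · left
    apply eq_order_of_one_mem hF hFE
    have h2 : algebraMap O A r ∈ F := by
      rw [eq_sub_of_add_eq hr'.symm]
      exact sub_mem (hp hF hFE hε) (hπF (mem_span_algebraMap_mul.2 ⟨y, hy, rfl⟩))
    obtain ⟨u, rfl⟩ := hru
    have := F.smul_mem (↑u⁻¹ : O) h2
    rwa [Algebra.smul_def, ← map_mul, Units.inv_mul, map_one] at this
  · right
    apply eq_order_of_one_mem hC hCE
    have hrm : r ∈ Ideal.span {π} := hπ ▸ (IsLocalRing.mem_maximalIdeal r).2 hru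
    obtain ⟨t, rfl⟩ := Ideal.mem_span_singleton'.1 hrm
    rw [← hεc]
    refine add_mem (hπC (mem_span_algebraMap_mul.2 ⟨t • 1 + y, ?_, ?_⟩)) (hp hC hCE hc)
    · exact add_mem (G.smul_mem G.one_mem t) hy
    · rw [hr', smul_add, ← mul_smul, mul_comm, Algebra.algebraMap_eq_smul_one]

-- Nakayama's lemma; only the order, not `B`, has to be finitely generated.
omit [IsNoetherianRing O] in
theorem order_le_of_le_sup (hπ : IsLocalRing.maximalIdeal O = Ideal.span {π}) (hG : (E).FG)
    {B : Submodule O A} (h : E ≤ B ⊔ Submodule.span O {algebraMap O A π} * E) : E ≤ B := by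
  apply Submodule.le_of_le_smul_of_le_jacobson_bot (I := IsLocalRing.maximalIdeal O) hG
  · exact IsLocalRing.maximalIdeal_le_jacobson _
  · refine h.trans (sup_le_sup le_rfl ?_)
    intro x hx
    obtain ⟨y, hy, rfl⟩ := mem_span_algebraMap_mul.1 hx
    exact Submodule.smul_mem_smul (hπ ▸ Ideal.mem_span_singleton_self π) hy

/-- A proper integral invertible ideal is topologically nilpotent. -/
theorem exists_pow_le_of_invertible (hπ : IsLocalRing.maximalIdeal O = Ideal.span {π})
    {ϖ : A} (hϖ : algebraMap O A π * ϖ = 1) (hG : (E).FG)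
    (hcen : ∀ x ∈ G, (∀ y ∈ G, x * y = y * x) → ∃ r, x = algebraMap O A r)
    (hd : HasDualBases G) {B B' : Submodule O A} (h : IsInversePair E B B') (hB : B ≤ E) :
    B = E ∨ ∃ n, B ^ (n + 1) ≤ Submodule.span O {algebraMap O A π} * E := by
  set W : Submodule O A := Submodule.span O {algebraMap O A π} with hW
  set V : Submodule O A := Submodule.span O {ϖ} with hV
  have hϖ' : ϖ * algebraMap O A π = 1 := by rw [← Algebra.commutes, hϖ]
  have hWc (M : Submodule O A) : W * M = M * W := span_algebraMap_central π M
  have hϖc (x : A) : ϖ * x = x * ϖ := by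
    calc ϖ * x = ϖ * (x * algebraMap O A π) * ϖ := by rw [mul_assoc, mul_assoc, hϖ, mul_one]
      _ = x * ϖ := by rw [← Algebra.commutes, ← mul_assoc, hϖ', one_mul]
  have hVc (M : Submodule O A) : V * M = M * V := span_singleton_central hϖc M
  have hWV : W * V = 1 := by
    rw [hW, hV, Submodule.span_mul_span, Set.singleton_mul_singleton, hϖ, Submodule.one_eq_span]
  have hVW : V * W = 1 := by rw [hVc, hWV]
  -- `sup_order` adds the order itself, so the power of `B` is divided by π, `E` is added, and the
  -- sum is multiplied by π.
  have hM (n : ℕ) : ∃ N, IsInversePair E (B ^ (n + 1) ⊔ W * E) N := by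
    obtain ⟨N, hN⟩ := (((h.pow n).central_mul hVc hWc hVW)).sup_order hG hd
    have := hN.central_mul hWc hVc hWV
    rw [Submodule.mul_sup, ← mul_assoc, hWV, one_mul] at this
    exact ⟨_, this⟩
  choose N hN using hM
  have hBpow (n m : ℕ) (hnm : n ≤ m) : B ^ (m + 1) ≤ B ^ (n + 1) := by
    induction m, hnm using Nat.le_induction with
    | base => exact le_rfl
    | succ m hm ih =>
      rw [pow_succ]
      refine le_trans ?_ ih
      calc B ^ (m + 1) * B ≤ B ^ (m + 1) * E := mul_le_mul' le_rfl hB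
        _ = B ^ (m + 1) := (h.pow m).mul_right
  have hMmono (n m : ℕ) (hnm : n ≤ m) : B ^ (m + 1) ⊔ W * E ≤ B ^ (n + 1) ⊔ W * E :=
    sup_le_sup (hBpow n m hnm) le_rfl
  -- The ideals B^(n+1) + πE decrease, so their inverses increase. They are bounded by π⁻¹E, hence
  -- stationary: noetherianity gives a descending chain condition.
  have hNmono : Monotone N := by
    intro n m hnm
    calc N n = E * N n := (hN n).left_mul'.symm
      _ = N m * (B ^ (m + 1) ⊔ W * E) * N n := by rw [(hN m).inv_mul]
      _ ≤ N m * (B ^ (n + 1) ⊔ W * E) * N n :=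
        mul_le_mul' (mul_le_mul' le_rfl (hMmono n m hnm)) le_rfl
      _ = N m := by rw [mul_assoc, (hN n).mul_inv, (hN m).mul_right']
  have hNle (n : ℕ) : N n ≤ V * E := by
    calc N n = V * (N n * W) := by rw [← hWc, ← mul_assoc, hVW, one_mul]
      _ = V * (N n * (W * E)) := by
        rw [hWc E, ← mul_assoc (N n), (hN n).mul_right']
      _ ≤ V * (N n * (B ^ (n + 1) ⊔ W * E)) :=
        mul_le_mul' le_rfl (mul_le_mul' le_rfl le_sup_right)
      _ = V * E := by rw [(hN n).inv_mul]
  have hnoeth : IsNoetherian O (V * E : Submodule O A) :=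
    isNoetherian_of_fg_of_noetherian _ ((Submodule.fg_span_singleton ϖ).mul hG)
  obtain ⟨n, hn⟩ := monotone_stabilizes_iff_noetherian.2 hnoeth
    ⟨fun n => (N n).comap (V * E).subtype, fun n m hnm => Submodule.comap_mono (hNmono hnm)⟩
  have hNn (m : ℕ) (hnm : n ≤ m) : N m = N n := by
    have : Submodule.map (V * E).subtype ((N n).comap (V * E).subtype) =
        Submodule.map (V * E).subtype ((N m).comap (V * E).subtype) :=
      congrArg (Submodule.map (V * E).subtype) (hn m hnm)
    rw [Submodule.map_comap_subtype, Submodule.map_comap_subtype, inf_eq_right.2 (hNle _),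
      inf_eq_right.2 (hNle _)] at this
    exact this.symm
  set F : Submodule O A := B ^ (n + 1) ⊔ W * E with hFdef
  have hFm (m : ℕ) (hnm : n ≤ m) : B ^ (m + 1) ⊔ W * E = F := by
    have := (hN m).symm
    rw [hNn m hnm] at this
    exact this.inv_unique (hN n).symm
  have hEE := order_mul_order G
  have hFE : F ≤ E := by
    have := hMmono 0 n (Nat.zero_le _)
    refine this.trans (sup_le (by simpa using hB) ?_)
    intro x hx
    obtain ⟨y, hy, rfl⟩ := mem_span_algebraMap_mul.1 hx
    exact G.smul_mem hy _
  have hBF : B ^ (n + 1) ≤ F := hFdef ▸ le_sup_left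
  -- The stable value `F` is also B^(2n+2) + πE, and B^(2n+2) is the square of B^(n+1).
  have hsq : F ≤ F * F ⊔ W * E := by
    refine (hFm (n + 1 + n) (by omega)).ge.trans ?_
    refine sup_le ?_ le_sup_right
    refine le_sup_of_le_left ?_
    rw [add_assoc, pow_add]
    exact mul_le_mul' hBF hBF
  set C : Submodule O A := W * N n with hCdef
  have hCE : C ≤ E := by
    calc W * N n ≤ W * (V * E) := mul_le_mul' le_rfl (hNle n)
      _ = E := by rw [← mul_assoc, hWV, one_mul]
  have hC1 : E * C = C := by rw [hCdef, ← mul_assoc, ← hWc, mul_assoc, (hN n).left_mul']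
  have hC2 : C * E = C := by rw [hCdef, mul_assoc, (hN n).mul_right']
  have hFC : F * C = W * E := by rw [hCdef, ← mul_assoc, ← hWc, mul_assoc, (hN n).mul_inv]
  have hCF : C * F = W * E := by rw [hCdef, mul_assoc, (hN n).inv_mul]
  -- Multiply F ≤ F² + πE by F⁻¹: comaximality of `F` with C = πF⁻¹ expresses that `F` is idempotent
  -- modulo π.
  have hsup : F ⊔ C = E := by
    refine le_antisymm (sup_le hFE hCE) ?_
    calc E = F * N n := (hN n).mul_inv.symm
      _ ≤ (F * F ⊔ W * E) * N n := mul_le_mul' hsq le_rfl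
      _ = F ⊔ C := by
        rw [Submodule.sup_mul, mul_assoc, (hN n).mul_inv, (hN n).mul_right, mul_assoc,
          (hN n).left_mul']
  rcases eq_order_or_eq_order_of_comaximal hπ hG hcen (hN n).left_mul (hN n).mul_right hC1 hC2
    hsup hFC hCF with h1 | h1
  · left
    refine le_antisymm hB (order_le_of_le_sup hπ hG (h1.ge.trans ?_))
    exact sup_le_sup (by simpa using hBpow 0 n (Nat.zero_le _)) le_rfl
  · right
    refine ⟨n, ?_⟩
    have : F = W * E := by rw [← hFC, h1, (hN n).mul_right]
    rw [← this]
    exact le_sup_left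

/-- Over a discrete valuation ring, every invertible ideal is comparable with the order. -/
theorem le_or_le_of_invertible [Nontrivial A]
    (hπ : IsLocalRing.maximalIdeal O = Ideal.span {π})
    {ϖ : A} (hϖ : algebraMap O A π * ϖ = 1) (hG : (E).FG)
    (hcen : ∀ x ∈ G, (∀ y ∈ G, x * y = y * x) → ∃ r, x = algebraMap O A r)
    (hd : HasDualBases G) {I J : Submodule O A} (h : IsInversePair E I J) : I ≤ E ∨ E ≤ I := by
  obtain ⟨N, hN⟩ := h.sup_order hG hd
  -- With N = (I + E)⁻¹, the integral ideals N I and `N` are invertible with sum `E`. If N I = E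
  -- then `I` contains `E`; if N = E then `I` is contained in `E`; otherwise both have a power in
  -- πE, although these powers are comaximal.
  have hNI := hN.symm.mul h
  have hsup : N * I ⊔ N = E := by
    have := hN.inv_mul
    rwa [Submodule.mul_sup, hN.mul_right'] at this
  have key {B B' : Submodule O A} (h : IsInversePair E B B') (hB : B ≤ E) :=
    exists_pow_le_of_invertible hπ hϖ hG hcen hd h hB
  rcases key hNI (hsup ▸ le_sup_left) with h1 | ⟨n, hn⟩
  · right
    calc E ≤ I ⊔ E := le_sup_right
      _ = (I ⊔ E) * (N * I) := by rw [h1, hN.mul_right]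
      _ = I := by rw [← mul_assoc, hN.mul_inv, h.left_mul]
  rcases key hN.symm (hsup ▸ le_sup_right) with h1 | ⟨m, hm⟩
  · left
    calc I ≤ I ⊔ E := le_sup_left
      _ = (I ⊔ E) * N := by rw [h1, hN.mul_right]
      _ = E := hN.mul_inv
  · exfalso
    have h2 := comaximal_pow_pow hNI.left_mul hNI.mul_right hN.left_mul' hN.mul_right' hsup n m
    have h3 : E ≤ ⊥ := by
      apply order_le_of_le_sup hπ hG
      rw [← h2]
      exact le_sup_of_le_right (sup_le hn hm |>.trans (by rw [h2]))
    exact one_ne_zero ((Submodule.mem_bot O).1 (h3 G.one_mem))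

end Local

/-! ### Dual bases from projectivity of one-sided ideals -/

section Hereditary

variable {O : Type*} {A : Type*} [CommRing O] [Ring A] [Algebra O A] {G : Subalgebra O A}
  {S : Type*} [Ring S]

local notation "E" => Subalgebra.toSubmodule G

/-- The dual basis lemma for the right ideal `c M` of `S`. All of its coordinate functionals are
left multiplications by elements of `A`, read off at the central element `c`, which lies in `c M` as
1 ∈ M. -/
theorem exists_left_colon_of_hereditary (hS : IsHereditaryRing S) (j : S →+* A)
    (hj : Function.Injective j) (hrange : ∀ x, x ∈ G ↔ ∃ s, j s = x) {M : Submodule O A}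
    (hM' : E * M = M) (hM : M * E = M) (h1 : (1 : A) ∈ M) {c : O} (hc : IsUnit (algebraMap O A c))
    (hcM : ∀ m ∈ M, c • m ∈ G) : ∃ N, N * M ≤ E ∧ E ≤ M * N := by
  let X : Submodule Sᵐᵒᵖ S :=
    { carrier := {s | ∃ m ∈ M, j s = c • m}
      add_mem' := by
        rintro a b ⟨m, hm, ha⟩ ⟨n, hn, hb⟩
        exact ⟨m + n, add_mem hm hn, by rw [map_add, ha, hb, smul_add]⟩
      zero_mem' := ⟨0, zero_mem _, by simp⟩
      smul_mem' := by
        rintro t s ⟨m, hm, hs⟩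
        refine ⟨m * j t.unop, ?_, ?_⟩
        · rw [← hM]
          exact Submodule.mul_mem_mul hm ((hrange _).2 ⟨_, rfl⟩)
        · rw [MulOpposite.smul_eq_mul_unop, map_mul, hs, smul_mul_assoc] }
  obtain ⟨u, hu⟩ := hc
  obtain ⟨σ, hσ⟩ := (hS.right X).out
  obtain ⟨x₀, hx₀⟩ := (hrange _).1 (hcM 1 h1)
  have hx₀' : j x₀ = u := by rw [hx₀, hu, Algebra.algebraMap_eq_smul_one]
  have hucomm (a : A) : (u : A) * a = a * u := by rw [hu, Algebra.commutes]
  let y₀ : X := ⟨x₀, 1, h1, hx₀⟩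
  let N : Submodule O A :=
    { carrier := {n | ∀ m ∈ M, n * m ∈ G}
      add_mem' := fun ha hb m hm => by rw [add_mul]; exact add_mem (ha m hm) (hb m hm)
      zero_mem' := fun m _ => by rw [zero_mul]; exact zero_mem _
      smul_mem' := fun r n hn m hm => by rw [smul_mul_assoc]; exact G.smul_mem (hn m hm) r }
  refine ⟨N, Submodule.mul_le.2 fun n hn m hm => hn m hm, ?_⟩
  have h1MN : (1 : A) ∈ M * N := by
    have e1 : x₀ = ∑ y ∈ (σ y₀).support, (y : S) * (σ y₀ y).unop := by
      have := congrArg Subtype.val (hσ y₀)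
      rw [Finsupp.linearCombination_apply, Finsupp.sum, AddSubmonoidClass.coe_finsetSum] at this
      exact this.symm
    have e2 : (1 : A) = ∑ y ∈ (σ y₀).support, (↑u⁻¹ * j (y : S)) * j (σ y₀ y).unop := by
      simp only [mul_assoc, ← map_mul]
      rw [← Finset.mul_sum, ← map_sum, ← e1, hx₀', Units.inv_mul]
    rw [e2]
    refine sum_mem fun y _ => Submodule.mul_mem_mul ?_ ?_
    · obtain ⟨m, hm, hy⟩ := y.2
      rwa [hy, Algebra.smul_def, ← hu, Units.inv_mul_cancel_left]
    · intro m hm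
      obtain ⟨x, hx⟩ := (hrange _).1 (hcM m hm)
      let z : X := ⟨x, m, hm, hx⟩
      -- As `c` is central, (element c)·(cm) = (element cm)·c. Applying a coordinate of `σ` and
      -- cancelling `c` shows that the coordinate of `c` times `m` lies in the order.
      have e3 : MulOpposite.op x • y₀ = MulOpposite.op x₀ • z := by
        apply Subtype.ext
        apply hj
        change j (x₀ * x) = j (x * x₀)
        rw [map_mul, map_mul, hx₀', hucomm]
      have e4 := congrArg (fun f => (f y).unop) (congrArg σ e3)
      simp only [map_smul, Finsupp.smul_apply, smul_eq_mul,
        MulOpposite.unop_mul, MulOpposite.unop_op] at e4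
      have e5 := congrArg j e4
      rw [map_mul, map_mul, hx, hx₀', Algebra.smul_def, ← hu, hucomm, ← mul_assoc] at e5
      rw [u.isUnit.mul_right_cancel e5]
      exact (hrange _).2 ⟨_, rfl⟩
  calc E = 1 * E := (one_mul _).symm
    _ ≤ M * N * E := mul_le_mul' (Submodule.one_le.2 h1MN) le_rfl
    _ ≤ M * N := by
      rw [mul_assoc]
      refine mul_le_mul' le_rfl (Submodule.mul_le.2 fun n hn g hg m hm => ?_)
      rw [mul_assoc]
      exact hn _ (hM' ▸ Submodule.mul_mem_mul (M := E) hg hm)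

theorem exists_right_colon_of_hereditary (hS : IsHereditaryRing S) (j : S →+* A)
    (hj : Function.Injective j) (hrange : ∀ x, x ∈ G ↔ ∃ s, j s = x) {M : Submodule O A}
    (hM' : E * M = M) (hM : M * E = M) (h1 : (1 : A) ∈ M) {c : O} (hc : IsUnit (algebraMap O A c))
    (hcM : ∀ m ∈ M, c • m ∈ G) : ∃ N, M * N ≤ E ∧ E ≤ N * M := by
  let X : Submodule S S :=
    { carrier := {s | ∃ m ∈ M, j s = c • m}
      add_mem' := by
        rintro a b ⟨m, hm, ha⟩ ⟨n, hn, hb⟩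
        exact ⟨m + n, add_mem hm hn, by rw [map_add, ha, hb, smul_add]⟩
      zero_mem' := ⟨0, zero_mem _, by simp⟩
      smul_mem' := by
        rintro t s ⟨m, hm, hs⟩
        refine ⟨j t * m, ?_, ?_⟩
        · rw [← hM']
          exact Submodule.mul_mem_mul (M := E) ((hrange _).2 ⟨_, rfl⟩) hm
        · rw [smul_eq_mul, map_mul, hs, mul_smul_comm] }
  obtain ⟨u, hu⟩ := hc
  obtain ⟨σ, hσ⟩ := (hS.left X).out
  obtain ⟨x₀, hx₀⟩ := (hrange _).1 (hcM 1 h1)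
  have hx₀' : j x₀ = u := by rw [hx₀, hu, Algebra.algebraMap_eq_smul_one]
  have hucomm (a : A) : (u : A) * a = a * u := by rw [hu, Algebra.commutes]
  let y₀ : X := ⟨x₀, 1, h1, hx₀⟩
  let N : Submodule O A :=
    { carrier := {n | ∀ m ∈ M, m * n ∈ G}
      add_mem' := fun ha hb m hm => by rw [mul_add]; exact add_mem (ha m hm) (hb m hm)
      zero_mem' := fun m _ => by rw [mul_zero]; exact zero_mem _
      smul_mem' := fun r n hn m hm => by rw [mul_smul_comm]; exact G.smul_mem (hn m hm) r }
  refine ⟨N, Submodule.mul_le.2 fun m hm n hn => hn m hm, ?_⟩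
  have h1NM : (1 : A) ∈ N * M := by
    have e1 : x₀ = ∑ y ∈ (σ y₀).support, σ y₀ y * (y : S) := by
      have := congrArg Subtype.val (hσ y₀)
      rw [Finsupp.linearCombination_apply, Finsupp.sum, AddSubmonoidClass.coe_finsetSum] at this
      exact this.symm
    have e2 : (1 : A) = ∑ y ∈ (σ y₀).support, j (σ y₀ y) * (j (y : S) * ↑u⁻¹) := by
      simp only [← mul_assoc, ← map_mul]
      rw [← Finset.sum_mul, ← map_sum, ← e1, hx₀', Units.mul_inv]
    rw [e2]
    refine sum_mem fun y _ => Submodule.mul_mem_mul ?_ ?_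
    rotate_left
    · obtain ⟨m, hm, hy⟩ := y.2
      rwa [hy, Algebra.smul_def, ← hu, hucomm, Units.mul_inv_cancel_right]
    · intro m hm
      obtain ⟨x, hx⟩ := (hrange _).1 (hcM m hm)
      let z : X := ⟨x, m, hm, hx⟩
      have e3 : x • y₀ = x₀ • z := by
        apply Subtype.ext
        apply hj
        change j (x * x₀) = j (x₀ * x)
        rw [map_mul, map_mul, hx₀', hucomm]
      have e4 := congrArg (fun f => f y) (congrArg σ e3)
      simp only [map_smul, Finsupp.smul_apply, smul_eq_mul] at e4
      have e5 := congrArg j e4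
      rw [map_mul, map_mul, hx, hx₀', Algebra.smul_def, ← hu, mul_assoc] at e5
      rw [u.isUnit.mul_left_cancel e5]
      exact (hrange _).2 ⟨_, rfl⟩
  calc E = E * 1 := (mul_one _).symm
    _ ≤ E * (N * M) := mul_le_mul' le_rfl (Submodule.one_le.2 h1NM)
    _ ≤ N * M := by
      rw [← mul_assoc]
      refine mul_le_mul' (Submodule.mul_le.2 fun g hg n hn m hm => ?_) le_rfl
      rw [← mul_assoc]
      exact hn _ (hM ▸ Submodule.mul_mem_mul (N := E) hm hg)

/-- The dual basis property of an order which is hereditary as a ring. -/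
theorem hasDualBases_of_hereditary (hS : IsHereditaryRing S) (j : S →+* A)
    (hj : Function.Injective j) (hrange : ∀ x, x ∈ G ↔ ∃ s, j s = x)
    (hbdd : ∀ M : Submodule O A, M.FG →
      ∃ c : O, IsUnit (algebraMap O A c) ∧ ∀ m ∈ M, c • m ∈ G) : HasDualBases G := by
  intro M hM hM' hEM hfg
  obtain ⟨c, hc, hcM⟩ := hbdd M hfg
  have h1 : (1 : A) ∈ M := hEM G.one_mem
  exact ⟨exists_left_colon_of_hereditary hS j hj hrange hM hM' h1 hc hcM,
    exists_right_colon_of_hereditary hS j hj hrange hM hM' h1 hc hcM⟩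

end Hereditary

/-! ### Normal domains and their height one primes -/

section Normal

variable (R : Type*) [CommRing R] [IsDomain R] [IsNoetherianRing R] [IsIntegrallyClosed R]

/-- The localization is a normal noetherian local domain of dimension one, that is, a discrete
valuation ring. -/
theorem exists_maximalIdeal_localization_eq_span (p : Ideal R) [p.IsPrime] (hp : p.height = 1) :
    ∃ π : Localization.AtPrime p, π ≠ 0 ∧
      IsLocalRing.maximalIdeal (Localization.AtPrime p) = Ideal.span {π} := by
  have : IsIntegrallyClosed (Localization.AtPrime p) :=
    isIntegrallyClosed_of_isLocalization _ p.primeCompl p.primeCompl_le_nonZeroDivisors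
  have : IsNoetherianRing (Localization.AtPrime p) :=
    IsLocalization.isNoetherianRing p.primeCompl _ inferInstance
  have hm : (IsLocalRing.maximalIdeal (Localization.AtPrime p)).height = 1 := by
    rw [← IsLocalization.height_under p.primeCompl, Localization.AtPrime.under_maximalIdeal, hp]
  -- Item 3 of the list is integrally closed with no nonzero prime but the maximal one; item 4 is
  -- that the maximal ideal is principal.
  have h : (IsLocalRing.maximalIdeal (Localization.AtPrime p)).IsPrincipal :=
    ((tfae_of_isNoetherianRing_of_isLocalRing_of_isDomain (Localization.AtPrime p)).out
    3 4 rfl rfl).1 ⟨inferInstance, fun P hP hP' => by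
      by_contra hne
      have hlt := lt_of_le_of_ne (IsLocalRing.le_maximalIdeal hP'.ne_top) hne
      have := Ideal.height_strict_mono_of_isPrime_of_isPrime hlt
      rw [hm, Order.lt_one_iff, Ideal.height_eq_zero_iff_eq_bot] at this
      exact hP this⟩
  obtain ⟨π, hπ⟩ := h
  refine ⟨π, ?_, hπ⟩
  rintro rfl
  apply Ideal.ne_bot_of_height_eq_one hm
  rw [hπ]
  simp

variable {R}

/-- A noetherian integrally closed domain is the intersection of its localizations at the primes
of height one. -/
theorem mem_range_algebraMap_of_forall_height_one {K : Type*} [Field K] [Algebra R K]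
    [IsFractionRing R K] (x : K)
    (h : ∀ (p : Ideal R) [p.IsPrime], p.height = 1 → ∃ s ∉ p, ∃ r, s • x = algebraMap R K r) :
    ∃ r, x = algebraMap R K r := by
  by_contra hx
  let D (y : K) : Ideal R := (LinearMap.range (Algebra.linearMap R K)).comap
    (LinearMap.toSpanSingleton R K y)
  have hD (y : K) (r : R) : r ∈ D y ↔ ∃ t, algebraMap R K t = r • y := Iff.rfl
  -- Ideals of denominators of the multiples of `x` outside `R`. A maximal one is prime, and the
  -- rest of the proof shows that it has height one.
  let 𝒮 : Set (Ideal R) := {J | ∃ t : R, J = D (t • x) ∧ ¬ ∃ r, t • x = algebraMap R K r}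
  obtain ⟨p, ⟨t, rfl, ht⟩, hmax⟩ := set_has_maximal_iff_noetherian.2
    (inferInstance : IsNoetherian R R) 𝒮 ⟨D ((1 : R) • x), 1, rfl, by rwa [one_smul]⟩
  set y : K := t • x with hy
  have hprime : (D y).IsPrime := by
    refine ⟨fun htop => ?_, fun {a b} hab => or_iff_not_imp_right.2 fun hb => ?_⟩
    · have : (1 : R) ∈ D y := htop ▸ trivial
      obtain ⟨r, hr⟩ := (hD _ _).1 this
      exact ht ⟨r, by rw [hr, one_smul]⟩
    · have hle : D y ≤ D (b • y) := fun r hr => by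
        obtain ⟨q, hq⟩ := (hD _ _).1 hr
        exact (hD _ _).2 ⟨b * q, by rw [map_mul, hq, ← Algebra.smul_def, smul_comm]⟩
      have hmem : D (b • y) ∈ 𝒮 := by
        refine ⟨b * t, by rw [hy, smul_smul], fun ⟨r, hr⟩ => hb ((hD _ _).2 ⟨r, ?_⟩)⟩
        rw [← hr, hy, smul_smul]
      have heq : D y = D (b • y) := eq_of_le_of_not_lt hle (hmax _ hmem)
      rw [heq]
      obtain ⟨q, hq⟩ := (hD _ _).1 hab
      exact (hD _ _).2 ⟨q, by rw [hq, mul_smul]⟩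
  have hDx : D x ≤ D y := fun r hr => by
    obtain ⟨q, hq⟩ := (hD _ _).1 hr
    exact (hD _ _).2 ⟨t * q, by rw [map_mul, hq, ← Algebra.smul_def, hy, smul_comm]⟩
  have hbot : D y ≠ ⊥ := by
    obtain ⟨⟨r, s⟩, hrs⟩ := IsLocalization.surj (nonZeroDivisors R) x
    intro hb
    have : (s : R) ∈ D y := hDx ((hD _ _).2 ⟨r, by rw [← hrs, Algebra.smul_def, mul_comm]⟩)
    rw [hb, Ideal.mem_bot] at this
    exact nonZeroDivisors.ne_zero s.2 this
  have hone : (D y).height = 1 := by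
    apply le_antisymm
    -- Let p = D y. If p y ⊆ p, then `y` is integral over `R` by the determinant trick, hence in
    -- `R`. Otherwise some q ∈ p has u = q y ∉ p; then `p` is minimal over (q), and Krull's theorem
    -- bounds its height.
    · by_cases hint : ∀ q ∈ D y, ∀ u, algebraMap R K u = q • y → u ∈ D y
      · exfalso
        apply ht
        have hi : IsIntegral R y := by
          refine isIntegral_of_smul_mem_submodule (Submodule.map (Algebra.linearMap R K) (D y)) ?_
            ((IsNoetherian.noetherian (D y)).map _) y ?_
          · exact fun h0 => hbot (Submodule.map_injective_of_injective
              (f := Algebra.linearMap R K) (IsFractionRing.injective R K)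
              (h0.trans (Submodule.map_bot _).symm))
          · rintro _ ⟨q, hq, rfl⟩
            obtain ⟨u, hu⟩ := (hD _ _).1 hq
            refine ⟨u, hint q hq u hu, ?_⟩
            rw [Algebra.linearMap_apply, hu, Algebra.linearMap_apply, Algebra.smul_def, mul_comm,
              smul_eq_mul]
        obtain ⟨r, hr⟩ := IsIntegrallyClosed.isIntegral_iff.1 hi
        exact ⟨r, hr.symm⟩
      · push Not at hint
        obtain ⟨q, hq, u, hu, hup⟩ := hint
        refine Ideal.height_le_one_of_isPrincipal_of_mem_minimalPrimes (Ideal.span {q}) _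
          ⟨⟨hprime, (Ideal.span_singleton_le_iff_mem _).2 hq⟩, ?_⟩
        rintro P ⟨hP, hqP⟩ hPD r hr
        obtain ⟨w, hw⟩ := (hD _ _).1 hr
        have : r * u = w * q := by
          apply IsFractionRing.injective R K
          rw [map_mul, map_mul, hu, hw, Algebra.smul_def, Algebra.smul_def]
          ring
        have hru : r * u ∈ P := by
          rw [this]
          exact P.mul_mem_left _ (hqP (Ideal.mem_span_singleton_self q))
        exact (hP.mem_or_mem hru).resolve_right fun h => hup (hPD h)
    · rw [Order.one_le_iff_ne_zero, Ne, Ideal.height_eq_zero_iff_eq_bot]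
      exact hbot
  -- The hypothesis at `p = D y` gives a denominator of `x` outside `p`, but every denominator of
  -- `x` is one of `y`.
  obtain ⟨s, hs, r, hr⟩ := h (D y) hone
  exact hs (hDx ((hD _ _).2 ⟨r, hr.symm⟩))

end Normal

/-! ### Tops of modules over a finite algebra over a local ring -/

section Tops

variable {R : Type*} [CommRing R] [IsLocalRing R]
  {S : Type*} [Ring S] [Algebra R S]
  {M : Type*} [AddCommGroup M] [Module R M] [Module S M] [IsScalarTower R S M]

theorem isArtinian_of_maximalIdeal_smul_eq_zero [Module.Finite R M]
    (h : ∀ r ∈ IsLocalRing.maximalIdeal R, ∀ x : M, r • x = 0) : IsArtinian R M := by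
  have ht : Module.IsTorsionBySet R M (IsLocalRing.maximalIdeal R : Set R) :=
    fun x r => h r r.2 x
  let := ht.module
  let : Field (R ⧸ IsLocalRing.maximalIdeal R) := Ideal.Quotient.field _
  have : IsSemisimpleModule (R ⧸ IsLocalRing.maximalIdeal R) M := inferInstance
  have : IsSemisimpleModule R M := (Module.IsTorsionBySet.isSemisimpleModule_iff ht).1 this
  infer_instance

variable (R S M) in
/-- The product of `M` with the maximal ideal of `R`, as an `S`-submodule. -/
def maximalIdealSMulTop : Submodule S M where
  carrier := (IsLocalRing.maximalIdeal R • ⊤ : Submodule R M)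
  add_mem' ha hb := add_mem ha hb
  zero_mem' := zero_mem _
  smul_mem' s y hy := by
    induction hy using Submodule.smul_induction_on' with
    | smul a ha n _ =>
      rw [smul_comm]
      exact Submodule.smul_mem_smul ha trivial
    | add a _ b _ ha hb =>
      rw [smul_add]
      exact add_mem ha hb

variable (S) in
theorem smul_mem_maximalIdealSMulTop {r : R} (hr : r ∈ IsLocalRing.maximalIdeal R) (x : M) :
    r • x ∈ maximalIdealSMulTop R S M :=
  Submodule.smul_mem_smul (N := (⊤ : Submodule R M)) hr Submodule.mem_top

/-- Otherwise N + 𝔪M = M, and Nakayama's lemma over `R` gives N = M. -/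
theorem maximalIdealSMulTop_le_of_isCoatom [Module.Finite R M] {N : Submodule S M}
    (hN : IsCoatom N) : maximalIdealSMulTop R S M ≤ N := by
  by_contra hx
  have hsup : N ⊔ maximalIdealSMulTop R S M = ⊤ := hN.2 _ (left_lt_sup.2 hx)
  apply hN.1
  have : (⊤ : Submodule R M) ≤ N.restrictScalars R := by
    apply Submodule.le_of_le_smul_of_le_jacobson_bot (I := IsLocalRing.maximalIdeal R)
      Module.Finite.fg_top (IsLocalRing.maximalIdeal_le_jacobson _)
    intro m _
    have hm : m ∈ N ⊔ maximalIdealSMulTop R S M := hsup ▸ trivial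
    obtain ⟨n, hn, y, hy, rfl⟩ := Submodule.mem_sup.1 hm
    have hn' : n ∈ N.restrictScalars R := hn
    have hy' : y ∈ (IsLocalRing.maximalIdeal R • ⊤ : Submodule R M) := hy
    exact Submodule.add_mem_sup hn' hy'
  rw [eq_top_iff]
  intro m hm
  exact this (Submodule.mem_top (R := R))

theorem smul_mem_jacobson [Module.Finite R M] {r : R}
    (hr : r ∈ IsLocalRing.maximalIdeal R) (x : M) : r • x ∈ Module.jacobson S M := by
  rw [Module.jacobson, Submodule.mem_sInf]
  intro N hN
  exact maximalIdealSMulTop_le_of_isCoatom (R := R) hN (smul_mem_maximalIdealSMulTop S hr x)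

variable (R S M)

theorem isArtinian_quotient_jacobson [Module.Finite R M] :
    IsArtinian S (M ⧸ Module.jacobson S M) := by
  have : IsArtinian R (M ⧸ Module.jacobson S M) := by
    apply isArtinian_of_maximalIdeal_smul_eq_zero
    intro r hr x
    obtain ⟨x, rfl⟩ := Submodule.mkQ_surjective _ x
    have h0 := (Submodule.Quotient.mk_eq_zero _).2 (smul_mem_jacobson (S := S) hr x)
    rw [← h0]
    exact (LinearMap.map_smul ((Module.jacobson S M).mkQ.restrictScalars R) r x).symm
  exact isArtinian_of_tower R this

theorem isSemisimpleModule_quotient_jacobson [Module.Finite R M] :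
    IsSemisimpleModule S (M ⧸ Module.jacobson S M) := by
  have := isArtinian_quotient_jacobson R S M
  rw [IsArtinian.isSemisimpleModule_iff_jacobson]
  exact Module.jacobson_quotient_jacobson S M

variable {R S M}

theorem eq_top_of_sup_jacobson_eq_top [Module.Finite S M] {N : Submodule S M}
    (h : N ⊔ Module.jacobson S M = ⊤) : N = ⊤ := by
  by_contra hN
  obtain ⟨C, hC, hNC⟩ := (eq_top_or_exists_le_coatom N).resolve_left hN
  apply hC.1
  rw [eq_top_iff, ← h]
  exact sup_le hNC (sInf_le hC)

variable (R S)

/-- Up to isomorphism there are only finitely many simple modules over a finite algebra over a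
local ring. -/
theorem exists_simple_modules [Module.Finite R S] :
    ∃ (n : ℕ) (T : Fin n → Submodule S (S ⧸ Module.jacobson S S)),
      (∀ i, IsSimpleModule S (T i)) ∧ ∀ (N : Type u) [AddCommGroup N] [Module S N]
        [IsSimpleModule S N], ∃ i, Nonempty (N ≃ₗ[S] T i) := by
  have := isSemisimpleModule_quotient_jacobson R S S
  obtain ⟨n, T, e, hT⟩ :=
    IsSemisimpleModule.exists_linearEquiv_fin_dfinsupp S (S ⧸ Module.jacobson S S)
  refine ⟨n, T, hT, fun N _ _ hN => ?_⟩
  have := IsSimpleModule.nontrivial S N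
  obtain ⟨x, hx⟩ := exists_ne (0 : N)
  have hsurj := IsSimpleModule.toSpanSingleton_surjective S hx
  have hle : Module.jacobson S S ≤ LinearMap.ker (LinearMap.toSpanSingleton S N x) :=
    sInf_le (LinearMap.isCoatom_ker_of_surjective hsurj)
  -- A simple module is a quotient of `S` by a maximal left ideal, so of the semisimple top of `S`.
  -- Some simple summand of the top maps to it nontrivially, and Schur's lemma applies.
  let f : (Π₀ i : Fin n, T i) →ₗ[S] N := (Submodule.liftQ _ _ hle).comp e.symm.toLinearMap
  have hf : f ≠ 0 := by
    intro h0
    apply hx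
    have h1 := LinearMap.congr_fun h0 (e (Submodule.mkQ _ 1))
    rw [LinearMap.comp_apply, LinearEquiv.coe_coe, e.symm_apply_apply, Submodule.mkQ_apply,
      Submodule.liftQ_apply, LinearMap.toSpanSingleton_apply, one_smul] at h1
    exact h1
  have : ∃ i, f.comp (DFinsupp.lsingle i) ≠ 0 := by
    by_contra! hall
    exact hf (DFinsupp.lhom_ext' fun i => by rw [hall i, LinearMap.zero_comp])
  obtain ⟨i, hi⟩ := this
  have := hT i
  exact ⟨i, ⟨(LinearEquiv.ofBijective _ (LinearMap.bijective_of_ne_zero hi)).symm⟩⟩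

/-- Among infinitely many finite modules with tops of bounded length, two have isomorphic tops. -/
theorem exists_linearEquiv_quotient_jacobson [IsNoetherianRing R] [Module.Finite R S]
    (X : ℕ → Type u)
    [∀ n, AddCommGroup (X n)] [∀ n, Module R (X n)] [∀ n, Module S (X n)]
    [∀ n, IsScalarTower R S (X n)] [∀ n, Module.Finite R (X n)] (ℓ : ℕ)
    (hℓ : ∀ n, Module.length S (X n ⧸ Module.jacobson S (X n)) ≤ ℓ) :
    ∃ n m, n < m ∧ Nonempty ((X n ⧸ Module.jacobson S (X n)) ≃ₗ[S]
      (X m ⧸ Module.jacobson S (X m))) := by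
  obtain ⟨s, T, hT, hall⟩ := exists_simple_modules.{u} R S
  -- A top is coded by its length t ≤ ℓ and a list of `t` simple types. There are finitely many
  -- codes, so two indices share one.
  have key (n : ℕ) : ∃ (c : Σ t : Fin (ℓ + 1), (Fin t → Fin s)),
      Nonempty ((X n ⧸ Module.jacobson S (X n)) ≃ₗ[S] ∀ i : Fin c.1, T (c.2 i)) := by
    have := isSemisimpleModule_quotient_jacobson R S (X n)
    have : Module.Finite S (X n) := Module.Finite.of_restrictScalars_finite R S (X n)
    obtain ⟨t, U, e, hU⟩ :=
      IsSemisimpleModule.exists_linearEquiv_fin_dfinsupp S (X n ⧸ Module.jacobson S (X n))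
    have hU' (i : Fin t) : ∃ j, Nonempty (U i ≃ₗ[S] T j) := by
      have := hU i
      exact hall (U i)
    choose c hc using hU'
    have e' := e.trans ((DFinsupp.linearEquivFunOnFintype (R := S)).trans
      (LinearEquiv.piCongrRight fun i => (hc i).some))
    have ht : t ≤ ℓ := by
      have h1 := hℓ n
      rw [e'.length_eq, Module.length_pi_of_fintype] at h1
      have h2 (i : Fin t) : Module.length S (T (c i)) = 1 := by
        have := hT (c i)
        exact Module.length_eq_one S _
      simp only [h2, Finset.sum_const, Finset.card_univ, Fintype.card_fin, nsmul_eq_mul,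
        mul_one] at h1
      exact_mod_cast h1
    exact ⟨⟨⟨t, Nat.lt_succ_of_le ht⟩, c⟩, ⟨e'⟩⟩
  choose c hc using key
  obtain ⟨n, m, hnm, h⟩ := Finite.exists_ne_map_eq_of_infinite c
  have e1 := (hc n).some
  have e2 := (hc m).some
  rw [← h] at e2
  rcases lt_or_gt_of_ne hnm with hlt | hlt
  · exact ⟨n, m, hlt, ⟨e1.trans e2.symm⟩⟩
  · exact ⟨m, n, hlt, ⟨e2.trans e1.symm⟩⟩

end Tops

/-! ### A power of an invertible ideal is principal -/

section Principal

variable {R : Type*} [CommRing R] {A : Type u} [Ring A] [Algebra R A] {G : Subalgebra R A}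

local notation "E" => Subalgebra.toSubmodule G

/-- A submodule stable under left multiplication by `G`, as a left `G`-module. -/
def leftLattice (I : Submodule R A) (h : E * I = I) : Submodule G A where
  carrier := I
  add_mem' := add_mem
  zero_mem' := zero_mem _
  smul_mem' g x hx := by
    have := Submodule.mul_mem_mul (M := E) g.2 hx
    rwa [h] at this

theorem finite_leftLattice {I : Submodule R A} (h : E * I = I) (hI : I.FG) :
    Module.Finite R (leftLattice I h) :=
  Module.Finite.iff_fg.2 hI

/-- An isomorphism of the tops of two invertible ideals is induced by right
multiplication by an element. -/
theorem exists_mul_span_eq {I J I' J' : Submodule R A} (h : IsInversePair E I J)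
    (h' : IsInversePair E I' J') (hI' : I'.FG)
    (e : (leftLattice I h.left_mul ⧸ Module.jacobson G (leftLattice I h.left_mul)) ≃ₗ[G]
      (leftLattice I' h'.left_mul ⧸ Module.jacobson G (leftLattice I' h'.left_mul))) :
    ∃ a : A, I * Submodule.span R {a} = I' := by
  have := finite_leftLattice h'.left_mul hI'
  set X := leftLattice I h.left_mul with hX
  set X' := leftLattice I' h'.left_mul with hX'
  have : Module.Finite G X' := Module.Finite.of_restrictScalars_finite R G X'
  let φ : X →ₗ[G] X' ⧸ Module.jacobson G X' := e.toLinearMap.comp (Submodule.mkQ _)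
  have hφ : Function.Surjective φ := e.surjective.comp (Submodule.mkQ_surjective _)
  let ψ : X' →ₗ[G] X' ⧸ Module.jacobson G X' := Submodule.mkQ _
  have hψ : Function.Surjective ψ := Submodule.mkQ_surjective _
  -- Projectivity of `I` made explicit: for w = ∑ xᵢyᵢ in J * I, lift the image of each `yᵢ` to mᵢ
  -- in `I'` and take a = ∑ xᵢmᵢ. The case w = 1 lifts `φ` to right multiplication by `a`.
  have key (w : A) (hw : w ∈ J * I) : ∃ a ∈ J * I', ∀ z (hz : z ∈ I) (h1 : z * w ∈ I)
      (h2 : z * a ∈ I'), φ ⟨z * w, h1⟩ = ψ ⟨z * a, h2⟩ := by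
    induction hw using Submodule.mul_induction_on' with
    | mem_mul_mem x hx y hy =>
      obtain ⟨m, hm⟩ := hψ (φ ⟨y, hy⟩)
      refine ⟨x * m, Submodule.mul_mem_mul hx m.2, fun z hz h1 h2 => ?_⟩
      have hzx : z * x ∈ G := by
        have := Submodule.mul_mem_mul hz hx
        rwa [h.mul_inv] at this
      have e1 : (⟨z * (x * y), h1⟩ : X) = (⟨z * x, hzx⟩ : G) • ⟨y, hy⟩ :=
        Subtype.ext (mul_assoc z x y).symm
      have e2 : (⟨z * (x * m), h2⟩ : X') = (⟨z * x, hzx⟩ : G) • m :=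
        Subtype.ext (mul_assoc z x m).symm
      rw [e1, e2, map_smul, map_smul, hm]
    | add w hw w' hw' ih ih' =>
      obtain ⟨a, ha, h1⟩ := ih
      obtain ⟨a', ha', h1'⟩ := ih'
      refine ⟨a + a', add_mem ha ha', fun z hz h3 h4 => ?_⟩
      have hIJI {K : Submodule R A} (hK : E * K = K) {b : A} (hb : b ∈ J * K) : z * b ∈ K := by
        have := Submodule.mul_mem_mul hz hb
        rwa [← mul_assoc, h.mul_inv, hK] at this
      have e1 : (⟨z * (w + w'), h3⟩ : X) =
          ⟨z * w, hIJI h.left_mul hw⟩ + ⟨z * w', hIJI h.left_mul hw'⟩ :=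
        Subtype.ext (mul_add z w w')
      have e2 : (⟨z * (a + a'), h4⟩ : X') =
          ⟨z * a, hIJI h'.left_mul ha⟩ + ⟨z * a', hIJI h'.left_mul ha'⟩ :=
        Subtype.ext (mul_add z a a')
      rw [e1, e2, map_add, map_add, h1 z hz, h1' z hz]
  obtain ⟨a, ha, hza⟩ := key 1 (by rw [h.inv_mul]; exact G.one_mem)
  have hmem (z : A) (hz : z ∈ I) : z * a ∈ I' := by
    have := Submodule.mul_mem_mul hz ha
    rwa [← mul_assoc, h.mul_inv, h'.left_mul] at this
  let ρ : X →ₗ[G] X' :=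
    { toFun := fun z => ⟨z * a, hmem z z.2⟩
      map_add' := fun z z' => Subtype.ext (add_mul _ _ _)
      map_smul' := fun g z => Subtype.ext (mul_assoc (g : A) z a) }
  -- The lift is onto modulo the radical, hence onto by Nakayama's lemma.
  have hρ : LinearMap.range ρ = ⊤ := by
    apply eq_top_of_sup_jacobson_eq_top
    rw [eq_top_iff]
    intro m _
    obtain ⟨z, hz⟩ := hφ (ψ m)
    have h1 : ψ m = ψ (ρ z) := by
      rw [← hz]
      have := hza z z.2 (by rw [mul_one]; exact z.2) (hmem z z.2)
      simp only [mul_one] at this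
      exact this
    rw [Submodule.mem_sup]
    exact ⟨ρ z, ⟨z, rfl⟩, m - ρ z, (Submodule.Quotient.eq _).1 h1, by abel⟩
  refine ⟨a, le_antisymm ?_ ?_⟩
  · rw [Submodule.mul_le]
    intro z hz b hb
    obtain ⟨c, rfl⟩ := Submodule.mem_span_singleton.1 hb
    rw [mul_smul_comm]
    exact Submodule.smul_mem _ _ (hmem z hz)
  · intro m hm
    have : (⟨m, hm⟩ : X') ∈ LinearMap.range ρ := hρ ▸ Submodule.mem_top
    obtain ⟨z, hz⟩ := this
    have hz' : (z : A) * a = m := congrArg Subtype.val hz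
    rw [← hz']
    exact Submodule.mul_mem_mul z.2 (Submodule.mem_span_singleton_self a)

variable [IsLocalRing R]

/-- A submodule of the top of `I` pulls back to L with 𝔪I ≤ L ≤ I. Then J L lies between 𝔪Γ and Γ
and determines L, since `J` is invertible. The bound does not depend on `I`, which is what the
pigeonhole argument needs. -/
theorem length_quotient_jacobson_le {I J : Submodule R A}
    (h : IsInversePair E I J) (hI : I.FG) :
    Module.length G (leftLattice I h.left_mul ⧸ Module.jacobson G (leftLattice I h.left_mul)) ≤
      Module.length R (G ⧸ (IsLocalRing.maximalIdeal R • ⊤ : Submodule R G)) := by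
  have := finite_leftLattice h.left_mul hI
  set X := leftLattice I h.left_mul
  let L (N : Submodule G (X ⧸ Module.jacobson G X)) : Submodule R A :=
    ((N.comap (Submodule.mkQ _)).map X.subtype).restrictScalars R
  let Z (N : Submodule G (X ⧸ Module.jacobson G X)) : Submodule R G :=
    (J * L N).comap G.val.toLinearMap
  let f (N : Submodule G (X ⧸ Module.jacobson G X)) :
      Submodule R (G ⧸ (IsLocalRing.maximalIdeal R • ⊤ : Submodule R G)) :=
    (Z N).map (Submodule.mkQ _)
  have hLI (N) : L N ≤ I := by
    rintro _ ⟨x, -, rfl⟩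
    exact x.2
  have hEL (N) : E * L N = L N := by
    apply le_antisymm
    · rw [Submodule.mul_le]
      intro g hg x hx
      exact Submodule.smul_mem ((N.comap (Submodule.mkQ _)).map X.subtype) (⟨g, hg⟩ : G) hx
    · calc L N = 1 * L N := (one_mul _).symm
        _ ≤ E * L N := mul_le_mul' (one_le_order G) le_rfl
  have hjac (N) (r : R) (hr : r ∈ IsLocalRing.maximalIdeal R) (x : A) (hx : x ∈ I) :
      r • x ∈ L N := by
    have h1 := smul_mem_jacobson (S := G) hr (⟨x, hx⟩ : X)
    refine ⟨r • ⟨x, hx⟩, ?_, rfl⟩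
    rw [SetLike.mem_coe, Submodule.mem_comap, Submodule.mkQ_apply,
      (Submodule.Quotient.mk_eq_zero _).2 h1]
    exact zero_mem _
  have hZ (N) : (IsLocalRing.maximalIdeal R • ⊤ : Submodule R G) ≤ Z N := by
    rw [Submodule.smul_le]
    intro r hr g _
    have hg : (g : A) ∈ J * I := by rw [h.inv_mul]; exact g.2
    change r • (g : A) ∈ J * L N
    generalize (g : A) = g at hg
    induction hg using Submodule.mul_induction_on' with
    | mem_mul_mem y hy x hx =>
      rw [← mul_smul_comm]
      exact Submodule.mul_mem_mul hy (hjac N r hr x hx)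
    | add a _ b _ ha hb => rw [smul_add]; exact add_mem ha hb
  have hZ' (N) : (Z N).map G.val.toLinearMap = J * L N := by
    rw [Submodule.map_comap_eq, inf_eq_right]
    intro x hx
    have : x ∈ E := by
      rw [← h.inv_mul]
      exact mul_le_mul' le_rfl (hLI N) hx
    exact ⟨⟨x, this⟩, rfl⟩
  have hmono : Monotone f := by
    intro N N' hNN
    refine Submodule.map_mono (Submodule.comap_mono (mul_le_mul' le_rfl ?_))
    exact Submodule.map_mono (Submodule.comap_mono hNN)
  have hinj : Function.Injective f := by
    intro N N' hNN
    have h1 : Z N = Z N' := by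
      have := congrArg (Submodule.comap (Submodule.mkQ _)) hNN
      rwa [Submodule.comap_map_mkQ, Submodule.comap_map_mkQ, sup_eq_right.2 (hZ N),
        sup_eq_right.2 (hZ N')] at this
    have h2 : J * L N = J * L N' := by rw [← hZ', ← hZ', h1]
    have h3 : L N = L N' := by
      rw [← hEL N, ← hEL N', ← h.mul_inv, mul_assoc, mul_assoc, h2]
    have h4 := Submodule.restrictScalars_injective R G A h3
    have h5 := Submodule.map_injective_of_injective X.injective_subtype h4
    exact Submodule.comap_injective_of_surjective (Submodule.mkQ_surjective _) h5
  have := Order.krullDim_le_of_strictMono f (hmono.strictMono_of_injective hinj)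
  rw [← Module.coe_length, ← Module.coe_length] at this
  exact_mod_cast this

variable [IsNoetherianRing R]

/-- Over a local ring, some power of an invertible ideal of an order is principal. -/
theorem exists_pow_eq_order_mul_span (hG : (E).FG) {I J : Submodule R A}
    (h : IsInversePair E I J) :
    ∃ (n : ℕ) (a : A), I ^ (n + 1) = E * Submodule.span R {a} := by
  have : Module.Finite R G := Module.Finite.iff_fg.2 hG
  have hfg (n : ℕ) := (h.pow n).fg hG
  have (n : ℕ) := finite_leftLattice (h.pow n).left_mul (hfg n)
  set Q := G ⧸ (IsLocalRing.maximalIdeal R • ⊤ : Submodule R G)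
  have hQ : IsArtinian R Q := by
    apply isArtinian_of_maximalIdeal_smul_eq_zero
    intro r hr x
    obtain ⟨x, rfl⟩ := Submodule.mkQ_surjective _ x
    rw [← map_smul, Submodule.mkQ_apply, Submodule.Quotient.mk_eq_zero]
    exact Submodule.smul_mem_smul hr Submodule.mem_top
  obtain ⟨ℓ, hℓ⟩ := ENat.ne_top_iff_exists.1 (Module.length_ne_top (R := R) (M := Q))
  obtain ⟨n, m, hnm, ⟨e⟩⟩ := exists_linearEquiv_quotient_jacobson R G
    (fun n => leftLattice (I ^ (n + 1)) (h.pow n).left_mul) ℓ fun n =>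
      (length_quotient_jacobson_le (h.pow n) (hfg n)).trans hℓ.ge
  obtain ⟨a, ha⟩ := exists_mul_span_eq (h.pow n) (h.pow m) (hfg m) e
  obtain ⟨k, rfl⟩ := Nat.exists_eq_add_of_lt hnm
  refine ⟨k, a, ?_⟩
  -- Here m = n + k + 1, so I^(n+k+2) = I^(n+1) a, and multiplying by J^(n+1) leaves I^(k+1).
  calc I ^ (k + 1) = E * I ^ (k + 1) := (h.pow k).left_mul.symm
    _ = J ^ (n + 1) * I ^ (n + k + 1 + 1) := by
      rw [← (h.pow n).inv_mul, mul_assoc, ← pow_add]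
      congr 2
      omega
    _ = E * Submodule.span R {a} := by
      rw [← ha, ← mul_assoc, (h.pow n).inv_mul]

end Principal

/-! ### Density for central simple algebras -/

section Density

/-- The multiplication algebra of a central simple algebra is the whole endomorphism algebra. -/
theorem eq_top_of_mulLeft_mem_of_mulRight_mem {K A : Type*} [Field K] [Ring A] [Algebra K A]
    [IsSimpleRing A] [FiniteDimensional K A] [Algebra.IsCentral K A]
    (B : Subalgebra K (Module.End K A)) (hl : ∀ a, LinearMap.mulLeft K a ∈ B)
    (hr : ∀ a, LinearMap.mulRight K a ∈ B) : B = ⊤ := by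
  have hsimple : IsSimpleModule B A := by
    rw [isSimpleModule_iff]
    refine { exists_pair_ne := ⟨⊥, ⊤, bot_ne_top⟩, eq_bot_or_eq_top := fun N => ?_ }
    rw [or_iff_not_imp_left]
    intro hN
    obtain ⟨x, hx, hx0⟩ := (Submodule.ne_bot_iff N).1 hN
    let I : TwoSidedIdeal A := TwoSidedIdeal.mk' N (zero_mem _) add_mem
      (fun {a} ha => by
        have := N.smul_mem (⟨_, hl (-1)⟩ : B) ha
        rwa [Subalgebra.smul_def, Module.End.smul_def, LinearMap.mulLeft_apply, neg_one_mul] at this)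
      (fun {a b} hb => N.smul_mem (⟨_, hl a⟩ : B) hb) (fun {a b} ha => N.smul_mem (⟨_, hr b⟩ : B) ha)
    have hI (y : A) : y ∈ I ↔ y ∈ N := TwoSidedIdeal.mem_mk' _ _ _ _ _ _ _
    have h1 := IsSimpleRing.one_mem_of_ne_zero_mem I hx0 ((hI x).2 hx)
    rw [eq_top_iff]
    intro y _
    rw [← mul_one y, ← hI]
    exact I.mul_mem_left _ _ h1
  rw [eq_top_iff]
  intro g _
  -- The commutant consists of bimodule endomorphisms, which are scalars. So every K-linear map
  -- commutes with it, and density on a finite basis places the map in `B`.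
  have hend (φ : Module.End B A) : ∃ c : K, ∀ a, φ a = c • a := by
    have h1 (a b : A) : φ (a * b) = a * φ b := φ.map_smul (⟨_, hl a⟩ : B) b
    have h2 (a b : A) : φ (a * b) = φ a * b := φ.map_smul (⟨_, hr b⟩ : B) a
    have hz : φ 1 ∈ Subalgebra.center K A := by
      rw [Subalgebra.mem_center_iff]
      intro b
      rw [← h1, ← h2, mul_one, one_mul]
    obtain ⟨c, hc⟩ := (Algebra.IsCentral.mem_center_iff K).1 hz
    refine ⟨c, fun a => ?_⟩
    have := h1 a 1
    rw [mul_one, hc] at this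
    rw [this, ← Algebra.commutes, ← Algebra.smul_def]
  let f : Module.End (Module.End B A) A :=
    { toFun := g
      map_add' := map_add g
      map_smul' := fun φ a => by
        obtain ⟨c, hc⟩ := hend φ
        change g (φ a) = φ (g a)
        rw [hc, hc, map_smul] }
  let b := Module.finBasis K A
  classical
  obtain ⟨r, hr'⟩ := jacobson_density (R := B) f (Finset.univ.image b)
  have : g = r := by
    apply b.ext
    intro i
    exact hr' (b i) (Finset.mem_image_of_mem _ (Finset.mem_univ i))
  rw [this]
  exact r.2

end Density

/-! ### Centralizing elements of bimodules -/

section Enveloping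

variable (R : Type*) [CommRing R] (Γ : Type*) [Ring Γ] [Algebra R Γ]
  (M : Type*) [AddCommGroup M] [Module R M] [Module Γ M] [Module Γᵐᵒᵖ M]
  [SMulCommClass Γ Γᵐᵒᵖ M] [IsScalarTower R Γ M] [IsScalarTower R Γᵐᵒᵖ M]

/-- The action of the enveloping algebra of `Γ` on an `R`-central bimodule. -/
def envelopingAction : Γ ⊗[R] Γᵐᵒᵖ →ₐ[R] Module.End R M :=
  Algebra.TensorProduct.lift (Algebra.lsmul R R M) (Algebra.lsmul R R M)
    fun a b => LinearMap.ext fun m => smul_comm a b m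

theorem envelopingAction_tmul (a b : Γ) (m : M) :
    envelopingAction R Γ M (a ⊗ₜ MulOpposite.op b) m = a • MulOpposite.op b • m := rfl

variable (K : Type*) [Field K] [Algebra R K]

/-- The base change of the action of the enveloping algebra on a bimodule. -/
def envelopingActionBaseChange :
    K ⊗[R] (Γ ⊗[R] Γᵐᵒᵖ) →ₐ[K] Module.End K (K ⊗[R] M) :=
  Algebra.TensorProduct.lift (Algebra.ofId K _)
    ((Module.End.baseChangeHom R K M).comp (envelopingAction R Γ M))
    fun c _ => show Commute _ _ from Algebra.commutes c _

theorem envelopingActionBaseChange_tmul (c d : K) (e : Γ ⊗[R] Γᵐᵒᵖ) (m : M) :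
    envelopingActionBaseChange R Γ M K (c ⊗ₜ e) (d ⊗ₜ m) =
      (c * d) ⊗ₜ (envelopingAction R Γ M e m) := by
  refine (LinearMap.congr_fun (Algebra.TensorProduct.lift_tmul _ _ _ c e) (d ⊗ₜ m)).trans ?_
  change c • (d ⊗ₜ[R] (envelopingAction R Γ M e m)) = _
  rw [TensorProduct.smul_tmul', smul_eq_mul]

theorem envelopingActionBaseChange_one (x : K ⊗[R] M) :
    envelopingActionBaseChange R Γ M K 1 x = x := by
  induction x using TensorProduct.induction_on with
  | zero => exact LinearMap.map_zero _
  | tmul c m =>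
    rw [Algebra.TensorProduct.one_def, envelopingActionBaseChange_tmul, one_mul,
      Algebra.TensorProduct.one_def, ← MulOpposite.op_one, envelopingAction_tmul,
      MulOpposite.op_one, one_smul, one_smul]
  | add x y hx hy => rw [LinearMap.map_add, hx, hy]

variable {R Γ M K}

/-- The image contains all left and right multiplications, so it is everything; injectivity follows
since both dimensions are the square of that of K ⊗ Γ. -/
theorem envelopingActionBaseChange_bijective [Module.Finite R Γ] [IsSimpleRing (K ⊗[R] Γ)]
    [Algebra.IsCentral K (K ⊗[R] Γ)] :
    Function.Bijective (envelopingActionBaseChange R Γ Γ K) := by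
  have hsurj : Function.Surjective (envelopingActionBaseChange R Γ Γ K) := by
    rw [← AlgHom.range_eq_top]
    apply eq_top_of_mulLeft_mem_of_mulRight_mem
    · intro a
      induction a using TensorProduct.induction_on with
      | zero => rw [LinearMap.mulLeft_zero_eq_zero]; exact zero_mem _
      | tmul c γ =>
        refine ⟨c ⊗ₜ (γ ⊗ₜ 1), ?_⟩
        ext x
        simp [envelopingActionBaseChange_tmul, envelopingAction_tmul, ← MulOpposite.op_one]
      | add x y hx hy =>
        have : LinearMap.mulLeft K (x + y) = LinearMap.mulLeft K x + LinearMap.mulLeft K y :=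
          LinearMap.ext fun z => add_mul x y z
        rw [this]; exact add_mem hx hy
    · intro a
      induction a using TensorProduct.induction_on with
      | zero => rw [LinearMap.mulRight_zero_eq_zero]; exact zero_mem _
      | tmul c γ =>
        refine ⟨c ⊗ₜ (1 ⊗ₜ MulOpposite.op γ), ?_⟩
        ext x
        simp [envelopingActionBaseChange_tmul, envelopingAction_tmul]
      | add x y hx hy =>
        have : LinearMap.mulRight K (x + y) = LinearMap.mulRight K x + LinearMap.mulRight K y :=
          LinearMap.ext fun z => mul_add z x y
        rw [this]; exact add_mem hx hy
  refine ⟨?_, hsurj⟩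
  have hop : Module.finrank K (K ⊗[R] Γᵐᵒᵖ) = Module.finrank K (K ⊗[R] Γ) :=
    ((MulOpposite.opLinearEquiv R (M := Γ)).baseChange R K Γ Γᵐᵒᵖ).finrank_eq.symm
  have hfin : FiniteDimensional K (K ⊗[R] (Γ ⊗[R] Γᵐᵒᵖ)) := by
    have : Module.Finite R Γᵐᵒᵖ := Module.Finite.equiv (MulOpposite.opLinearEquiv R (M := Γ))
    infer_instance
  refine (LinearMap.injective_iff_surjective_of_finrank_eq_finrank
    (f := (envelopingActionBaseChange R Γ Γ K).toLinearMap) ?_).2 hsurj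
  rw [(TensorProduct.AlgebraTensorModule.distribBaseChange R K Γ Γᵐᵒᵖ).finrank_eq,
    Module.finrank_tensorProduct, hop, Module.finrank_linearMap]

/-- Every element of a central bimodule, after base change to the fraction field, is a combination
of centralizing elements. -/
theorem exists_decomposition_one [Module.Finite R Γ] [IsSimpleRing (K ⊗[R] Γ)]
    [Algebra.IsCentral K (K ⊗[R] Γ)] :
    ∃ (n : ℕ) (β ε : Fin n → K ⊗[R] (Γ ⊗[R] Γᵐᵒᵖ)), 1 = ∑ i, β i * ε i ∧
      ∀ (γ : Γ) i, (1 ⊗ₜ (γ ⊗ₜ 1 - 1 ⊗ₜ MulOpposite.op γ)) * ε i = 0 := by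
  have hbij := envelopingActionBaseChange_bijective (R := R) (Γ := Γ) (K := K)
  let b := Module.finBasis K (K ⊗[R] Γ)
  -- `β i` acts as left multiplication by the basis vector bᵢ, and `ε i` as x ↦ bᵢ*(x)·1. Hence ∑
  -- βᵢεᵢ is the basis expansion of x, and the commutators kill the image K·1 of `ε i`.
  choose β hβ using fun i => hbij.2 (LinearMap.mulLeft K (b i))
  choose ε hε using fun i => hbij.2 ((b.coord i).smulRight (1 : K ⊗[R] Γ))
  refine ⟨_, β, ε, ?_, fun γ i => ?_⟩
  · apply hbij.1
    rw [map_sum]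
    apply LinearMap.ext
    intro x
    simp only [map_mul, hβ, hε, LinearMap.sum_apply, Module.End.mul_apply, LinearMap.mulLeft_apply,
      LinearMap.smulRight_apply, mul_smul_comm, mul_one]
    rw [envelopingActionBaseChange_one]
    exact (b.sum_repr x).symm
  · apply hbij.1
    rw [map_mul, map_zero, hε]
    apply LinearMap.ext
    intro x
    rw [Module.End.mul_apply, LinearMap.smulRight_apply, map_smul,
      Algebra.TensorProduct.one_def, envelopingActionBaseChange_tmul, map_sub]
    simp [envelopingAction_tmul, ← MulOpposite.op_one]

/-- A nonzero torsion-free central bimodule contains a nonzero centralizing element. -/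
theorem exists_centralizing_element [IsDomain R] [IsFractionRing R K] [Module.Finite R Γ]
    [IsSimpleRing (K ⊗[R] Γ)] [Algebra.IsCentral K (K ⊗[R] Γ)] [Nontrivial M]
    (htf : ∀ (r : R) (m : M), r • m = 0 → r = 0 ∨ m = 0) :
    ∃ m : M, m ≠ 0 ∧ ∀ γ : Γ, γ • m = MulOpposite.op γ • m := by
  obtain ⟨n, β, ε, h1, hε⟩ := exists_decomposition_one (R := R) (Γ := Γ) (K := K)
  have hinj : Function.Injective (TensorProduct.mk R K M 1) := by
    rw [injective_iff_map_eq_zero]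
    intro m hm
    obtain ⟨s, hs⟩ := (IsLocalizedModule.eq_zero_iff (nonZeroDivisors R)
      (TensorProduct.mk R K M 1)).1 hm
    exact (htf _ _ hs).resolve_left (nonZeroDivisors.ne_zero s.2)
  obtain ⟨m, hm⟩ := exists_ne (0 : M)
  let Θ := envelopingActionBaseChange R Γ M K
  have : ∃ i, Θ (ε i) (1 ⊗ₜ m) ≠ 0 := by
    by_contra! h0
    apply hm
    apply hinj
    have := LinearMap.congr_fun (congrArg Θ h1) (1 ⊗ₜ m)
    rw [envelopingActionBaseChange_one, map_sum, LinearMap.sum_apply] at this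
    simpa [h0] using this
  obtain ⟨i, hi⟩ := this
  -- Each element in the image of `ε i` centralizes `Γ`; clearing its denominator brings it into
  -- `M`.
  obtain ⟨⟨m', s⟩, hm'⟩ := IsLocalizedModule.surj (nonZeroDivisors R)
    (TensorProduct.mk R K M 1) (Θ (ε i) (1 ⊗ₜ m))
  have hm' : s.1 • Θ (ε i) (1 ⊗ₜ m) = (1 : K) ⊗ₜ[R] m' := hm'
  refine ⟨m', ?_, fun γ => ?_⟩
  · rintro rfl
    rw [TensorProduct.tmul_zero, ← algebraMap_smul K, smul_eq_zero] at hm'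
    exact hm'.elim (fun h => nonZeroDivisors.ne_zero s.2
      ((FaithfulSMul.algebraMap_eq_zero_iff R K).1 h)) hi
  · have h2 : Θ (1 ⊗ₜ (γ ⊗ₜ 1 - 1 ⊗ₜ MulOpposite.op γ)) (s.1 • Θ (ε i) (1 ⊗ₜ m)) = 0 := by
      rw [← algebraMap_smul K, map_smul, ← Module.End.mul_apply, ← map_mul, hε, map_zero,
        LinearMap.zero_apply, smul_zero]
    rw [hm', envelopingActionBaseChange_tmul, map_sub] at h2
    have h3 := hinj (((congrArg (· ⊗ₜ[R] _) (mul_one (1 : K)).symm).trans h2).trans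
      (map_zero (TensorProduct.mk R K M 1)).symm)
    rw [LinearMap.sub_apply, sub_eq_zero, ← MulOpposite.op_one, envelopingAction_tmul,
      envelopingAction_tmul, one_smul, MulOpposite.op_one, one_smul] at h3
    exact h3

end Enveloping

/-! ### Norms of elements of an order -/

section Norm

variable {O K A : Type*} [CommRing O] [IsDomain O] [Field K] [Algebra O K] [IsFractionRing O K]
  [Ring A] [Algebra O A] [Algebra K A] [IsScalarTower O K A]

/-- By `hb` the algebra is the localization of `G`, so an O-basis of `G` is a K-basis of `A` and
both norms are determinants of the same matrix. -/
theorem norm_coe_order (G : Subalgebra O A) [Module.Free O G] [Module.Finite O G]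
    (hb : ∀ a : A, ∃ c : O, c ≠ 0 ∧ c • a ∈ G) (x : G) :
    Algebra.norm K (x : A) = algebraMap O K (Algebra.norm O x) := by
  have hloc : IsLocalizedModule (nonZeroDivisors O) G.val.toLinearMap :=
    { map_units := fun s => by
        have hs : algebraMap O K s ≠ 0 := IsFractionRing.to_map_ne_zero_of_mem_nonZeroDivisors s.2
        have hsm (y : A) : algebraMap O (Module.End O A) s y = algebraMap O K s • y := by
          rw [Module.algebraMap_end_apply, algebraMap_smul]
        rw [Module.End.isUnit_iff]
        refine ⟨fun y z hyz => ?_, fun y => ⟨(algebraMap O K s)⁻¹ • y, ?_⟩⟩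
        · rw [hsm, hsm] at hyz
          exact smul_right_injective A hs hyz
        · rw [hsm, smul_inv_smul₀ hs]
      surj := fun a => by
        obtain ⟨c, hc, hca⟩ := hb a
        exact ⟨⟨⟨c • a, hca⟩, ⟨c, mem_nonZeroDivisors_of_ne_zero hc⟩⟩, rfl⟩
      exists_of_eq := fun h => ⟨1, by rw [Subtype.ext h]⟩ }
  classical
  let b := Module.Free.chooseBasis O G
  let b' := b.ofIsLocalizedModule K (nonZeroDivisors O) G.val.toLinearMap
  rw [Algebra.norm_eq_matrix_det b', Algebra.norm_eq_matrix_det b, RingHom.map_det]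
  congr 1
  ext i j
  rw [Algebra.leftMulMatrix_eq_repr_mul, RingHom.mapMatrix_apply, Matrix.map_apply,
    Algebra.leftMulMatrix_eq_repr_mul, Module.Basis.ofIsLocalizedModule_apply]
  exact Module.Basis.ofIsLocalizedModule_repr_apply K (nonZeroDivisors O) G.val.toLinearMap b
    (x * b j) i

/-- Over a principal ideal domain `G` is free. Left multiplication by `x` on it has determinant one,
so it reaches 1. -/
theorem exists_mul_eq_one_of_norm_eq_one [IsPrincipalIdealRing O] (G : Subalgebra O A)
    (hG : (Subalgebra.toSubmodule G).FG) (hb : ∀ a : A, ∃ c : O, c ≠ 0 ∧ c • a ∈ G) {x : A}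
    (hx : x ∈ G) (h1 : Algebra.norm K x = 1) : ∃ y ∈ G, x * y = 1 := by
  have : Module.Finite O G := Module.Finite.iff_fg.2 hG
  have : Module.IsTorsionFree O A := Module.IsTorsionFree.trans_faithfulSMul O K A
  have : Module.IsTorsionFree O G := inferInstance
  have : Module.Free O G := inferInstance
  have h2 : Algebra.norm O (⟨x, hx⟩ : G) = 1 := by
    apply IsFractionRing.injective O K
    rw [← norm_coe_order G hb, h1, map_one]
  have h3 : IsUnit (LinearMap.mulLeft O (⟨x, hx⟩ : G)) := by
    rw [LinearMap.isUnit_iff_isUnit_det]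
    rw [Algebra.norm_apply] at h2
    exact h2 ▸ isUnit_one
  obtain ⟨y, hy⟩ := ((Module.End.isUnit_iff _).1 h3).2 1
  exact ⟨y, y.2, congrArg Subtype.val hy⟩

end Norm

/-! ### Ideals generated by normalizing units -/

section Normalizing

variable {O A : Type*} [CommRing O] [Ring A] [Algebra O A] {G : Subalgebra O A}

local notation "E" => Subalgebra.toSubmodule G

theorem isInversePair_span_unit_mul (a : Aˣ) (h1 : ∀ g ∈ G, (a : A) * g * ↑a⁻¹ ∈ G)
    (h2 : ∀ g ∈ G, (↑a⁻¹ : A) * g * a ∈ G) :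
    IsInversePair E (Submodule.span O {(a : A)} * E) (Submodule.span O {(↑a⁻¹ : A)} * E) := by
  have key (b : Aˣ) (h1 : ∀ g ∈ G, (b : A) * g * ↑b⁻¹ ∈ G) (h2 : ∀ g ∈ G, (↑b⁻¹ : A) * g * b ∈ G) :
      Submodule.span O {(b : A)} * E = E * Submodule.span O {(b : A)} := by
    apply le_antisymm
    · rw [Submodule.mul_le]
      intro m hm g hg
      obtain ⟨c, rfl⟩ := Submodule.mem_span_singleton.1 hm
      have : c • (b : A) * g = (b * g * ↑b⁻¹) * c • b := by
        rw [smul_mul_assoc, mul_smul_comm, Units.inv_mul_cancel_right]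
      rw [this]
      exact Submodule.mul_mem_mul (h1 g hg) hm
    · rw [Submodule.mul_le]
      intro g hg m hm
      obtain ⟨c, rfl⟩ := Submodule.mem_span_singleton.1 hm
      have : g * c • (b : A) = c • b * (↑b⁻¹ * g * b) := by
        rw [smul_mul_assoc, mul_smul_comm, mul_assoc, Units.mul_inv_cancel_left]
      rw [this]
      exact Submodule.mul_mem_mul hm (h2 g hg)
  have ka := key a h1 h2
  have ka' := key a⁻¹ (by rwa [inv_inv]) (by rwa [inv_inv])
  have hEE := order_mul_order G
  have haa : Submodule.span O {(a : A)} * Submodule.span O {(↑a⁻¹ : A)} = 1 := by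
    rw [Submodule.span_mul_span, Set.singleton_mul_singleton, Units.mul_inv,
      Submodule.one_eq_span]
  have haa' : Submodule.span O {(↑a⁻¹ : A)} * Submodule.span O {(a : A)} = 1 := by
    rw [Submodule.span_mul_span, Set.singleton_mul_singleton, Units.inv_mul,
      Submodule.one_eq_span]
  constructor
  · rw [← mul_assoc, ← ka, mul_assoc, hEE]
  · rw [mul_assoc, hEE]
  · rw [← mul_assoc, ← ka', mul_assoc, hEE]
  · rw [mul_assoc, hEE]
  · rw [mul_assoc, ← mul_assoc E, ← ka', mul_assoc _ E, hEE, ← mul_assoc, haa, one_mul]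
  · rw [mul_assoc, ← mul_assoc E, ← ka, mul_assoc _ E, hEE, ← mul_assoc, haa', one_mul]

end Normalizing

/-! ### The algebra K ⊗ Γ -/

section FractionAlgebra

variable (R : Type u) [CommRing R] [IsDomain R] (Γ : Type v) [Ring Γ] [Algebra R Γ]

/-- The algebra `K ⊗ Γ` over the fraction field `K` of `R`. -/
abbrev FractionAlgebra := FractionRing R ⊗[R] Γ

variable {R Γ}

theorem exists_smul_eq_one_tmul (a : FractionAlgebra R Γ) :
    ∃ r : R, r ≠ 0 ∧ ∃ γ : Γ, r • a = 1 ⊗ₜ γ := by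
  obtain ⟨⟨γ, s⟩, h⟩ := IsLocalizedModule.surj (nonZeroDivisors R)
    (TensorProduct.mk R (FractionRing R) Γ 1) a
  exact ⟨s, nonZeroDivisors.ne_zero s.2, γ, h⟩

theorem smul_fractionAlgebra_injective {r : R} (hr : r ≠ 0) {a b : FractionAlgebra R Γ}
    (h : r • a = r • b) : a = b := by
  rw [← algebraMap_smul (FractionRing R), ← algebraMap_smul (FractionRing R) r b] at h
  exact (smul_right_injective _
    ((FaithfulSMul.algebraMap_eq_zero_iff R (FractionRing R)).not.2 hr)) h

variable (htf : ∀ (r : R) (γ : Γ), r • γ = 0 → r = 0 ∨ γ = 0)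
include htf

theorem one_tmul_injective {γ γ' : Γ}
    (h : (1 : FractionRing R) ⊗ₜ[R] γ = 1 ⊗ₜ γ') : γ = γ' := by
  obtain ⟨s, hs⟩ := (IsLocalizedModule.eq_iff_exists (nonZeroDivisors R)
    (TensorProduct.mk R (FractionRing R) Γ 1)).1 h
  have h1 : s.1 • (γ - γ') = 0 := by rw [smul_sub, sub_eq_zero]; exact hs
  exact sub_eq_zero.1 ((htf _ _ h1).resolve_left (nonZeroDivisors.ne_zero s.2))

theorem isCentral_fractionAlgebra [Algebra.IsCentral R Γ] :
    Algebra.IsCentral (FractionRing R) (FractionAlgebra R Γ) where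
  out := by
    intro x hx
    rw [Subalgebra.mem_center_iff] at hx
    obtain ⟨r, hr, γ, hγ⟩ := exists_smul_eq_one_tmul x
    have hγc : γ ∈ Subalgebra.center R Γ := by
      rw [Subalgebra.mem_center_iff]
      intro b
      have h1 : (1 ⊗ₜ b) * (r • x) = (r • x) * (1 ⊗ₜ b) := by
        rw [mul_smul_comm, smul_mul_assoc, hx]
      rw [hγ, Algebra.TensorProduct.tmul_mul_tmul, Algebra.TensorProduct.tmul_mul_tmul] at h1
      exact one_tmul_injective htf (by simpa using h1)
    obtain ⟨c, hc⟩ := (Algebra.IsCentral.mem_center_iff R).1 hγc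
    rw [Algebra.mem_bot]
    refine ⟨algebraMap R _ c / algebraMap R _ r, ?_⟩
    apply smul_fractionAlgebra_injective hr
    rw [hγ, hc, Algebra.TensorProduct.algebraMap_apply, TensorProduct.smul_tmul', Algebra.smul_def,
      Algebra.algebraMap_self_apply, mul_div_cancel₀, Algebra.algebraMap_eq_smul_one,
      Algebra.algebraMap_eq_smul_one, TensorProduct.smul_tmul]
    exact (FaithfulSMul.algebraMap_eq_zero_iff R (FractionRing R)).not.2 hr

end FractionAlgebra

/-! ### Central denominators and simplicity of K ⊗ Γ -/

section PrimeOrder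

variable {R : Type u} [CommRing R] [IsDomain R] {Γ : Type v} [Ring Γ] [Algebra R Γ]
  {A₀ : Type w} [Ring A₀] {ι : Γ →+* A₀}

omit [IsDomain R] in
theorem IsPrimeOrder.eq_zero_or_eq_zero_of_smul (h : IsPrimeOrder R ι) (r : R) (γ : Γ)
    (hr : r • γ = 0) : r = 0 ∨ γ = 0 := by
  refine (h.isPrimeRing.eq_zero_or_eq_zero (algebraMap R Γ r) γ fun x => ?_).imp_left fun h0 => ?_
  · rw [Algebra.commutes, mul_assoc, ← Algebra.smul_def, hr, mul_zero]
  · exact h.algebraMap_injective (h0.trans (map_zero _).symm)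

/-- An integral equation for the regular element `t` can be divided by powers of `t` until its
constant term is nonzero; that term is a multiple of `t`. Consequently central denominators suffice.
-/
theorem IsPrimeOrder.exists_mul_eq_algebraMap (h : IsPrimeOrder R ι) {t : Γ}
    (ht : t ∈ nonZeroDivisors Γ) : ∃ c : Γ, ∃ r : R, r ≠ 0 ∧ t * c = algebraMap R Γ r := by
  have := h.finite
  have := h.isPrimeRing.nontrivial
  obtain ⟨c, -, r, hr, hc⟩ :=
    (Algebra.IsIntegral.isIntegral (R := R) t).isAlgebraic.exists_nonzero_eq_adjoin_mul ht
  exact ⟨c, r, hr, hc⟩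

omit [IsDomain R] in
theorem IsPrimeOrder.commute_map_algebraMap (h : IsPrimeOrder R ι) (r : R) (a : A₀) :
    Commute (ι (algebraMap R Γ r)) a := by
  obtain ⟨t, ht, y, hy⟩ := h.isRingOfFractions.right_fraction a
  apply (h.isRingOfFractions.isUnit t ht).mul_right_cancel
  rw [mul_assoc, hy, mul_assoc, ← map_mul, ← map_mul, Algebra.commutes, Algebra.commutes,
    map_mul, map_mul, ← hy, mul_assoc]

theorem IsPrimeOrder.exists_map_algebraMap_mul_eq (h : IsPrimeOrder R ι) (a : A₀) :
    ∃ r : R, r ≠ 0 ∧ ∃ y, ι (algebraMap R Γ r) * a = ι y := by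
  obtain ⟨t, ht, y, hy⟩ := h.isRingOfFractions.right_fraction a
  obtain ⟨c, r, hr, hc⟩ := h.exists_mul_eq_algebraMap ht
  refine ⟨r, hr, y * c, ?_⟩
  rw [h.commute_map_algebraMap, ← hc, map_mul, map_mul, ← hy, mul_assoc]

theorem IsPrimeOrder.exists_algebraMap_mem (h : IsPrimeOrder R ι) (𝔞 : TwoSidedIdeal Γ)
    (h0 : ∃ x ∈ 𝔞, x ≠ 0) : ∃ r : R, r ≠ 0 ∧ algebraMap R Γ r ∈ 𝔞 := by
  have := h.isSimpleRing
  obtain ⟨x, hx, hx0⟩ := h0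
  -- The ideal of `A₀` generated by `𝔞`, described by central denominators. Simplicity puts 1 in it,
  -- and a denominator of 1 is the scalar sought.
  let J := TwoSidedIdeal.mk' {a : A₀ | ∃ r : R, r ≠ 0 ∧ ∃ y ∈ 𝔞, ι (algebraMap R Γ r) * a = ι y}
    ⟨1, one_ne_zero, 0, 𝔞.zero_mem, by simp⟩
    (by
      rintro a b ⟨r, hr, y, hy, e⟩ ⟨s, hs, z, hz, e'⟩
      refine ⟨r * s, mul_ne_zero hr hs, algebraMap R Γ s * y + algebraMap R Γ r * z,
        𝔞.add_mem (𝔞.mul_mem_left _ _ hy) (𝔞.mul_mem_left _ _ hz), ?_⟩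
      rw [map_add, map_mul ι, map_mul ι, ← e, ← e', ← mul_assoc, ← mul_assoc, ← map_mul, ← map_mul,
        ← map_mul, ← map_mul, mul_comm s r, mul_add])
    (by
      rintro a ⟨r, hr, y, hy, e⟩
      exact ⟨r, hr, -y, 𝔞.neg_mem hy, by rw [mul_neg, e, map_neg]⟩)
    (by
      rintro a b ⟨r, hr, y, hy, e⟩
      obtain ⟨s, hs, z, e'⟩ := h.exists_map_algebraMap_mul_eq a
      refine ⟨s * r, mul_ne_zero hs hr, z * y, 𝔞.mul_mem_left _ _ hy, ?_⟩
      rw [map_mul, map_mul, map_mul, ← e, ← e', mul_assoc, ← mul_assoc _ a,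
        h.commute_map_algebraMap r a, mul_assoc, mul_assoc])
    (by
      rintro a b ⟨r, hr, y, hy, e⟩
      obtain ⟨s, hs, z, e'⟩ := h.exists_map_algebraMap_mul_eq b
      refine ⟨r * s, mul_ne_zero hr hs, y * z, 𝔞.mul_mem_right _ _ hy, ?_⟩
      rw [map_mul, map_mul, map_mul, ← e, ← e', mul_assoc, ← mul_assoc _ a,
        h.commute_map_algebraMap s a, mul_assoc, mul_assoc])
  have h1 : (1 : A₀) ∈ J := by
    apply IsSimpleRing.one_mem_of_ne_zero_mem J (x := ι x)
    · exact fun h0 => hx0 (h.isRingOfFractions.injective (h0.trans (map_zero ι).symm))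
    · rw [TwoSidedIdeal.mem_mk']
      exact ⟨1, one_ne_zero, x, hx, by simp⟩
  rw [TwoSidedIdeal.mem_mk'] at h1
  obtain ⟨r, hr, y, hy, e⟩ := h1
  rw [mul_one] at e
  exact ⟨r, hr, h.isRingOfFractions.injective e ▸ hy⟩

theorem IsPrimeOrder.isSimpleRing_fractionAlgebra (h : IsPrimeOrder R ι) :
    IsSimpleRing (FractionAlgebra R Γ) := by
  have := h.isPrimeRing.nontrivial
  have htf := h.eq_zero_or_eq_zero_of_smul
  have hnt : Nontrivial (FractionAlgebra R Γ) :=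
    ⟨1 ⊗ₜ 0, 1 ⊗ₜ 1, fun e => zero_ne_one (one_tmul_injective htf e)⟩
  refine .of_eq_bot_or_eq_top fun U => ?_
  rw [or_iff_not_imp_left, ← U.one_mem_iff]
  intro hU
  obtain ⟨a, ha, ha0⟩ : ∃ a ∈ U, a ≠ 0 := by
    by_contra! hc
    exact hU (eq_bot_iff.2 fun a ha => (TwoSidedIdeal.mem_bot _).2 (hc a ha))
  obtain ⟨r, hr, γ, hγ⟩ := exists_smul_eq_one_tmul a
  have hγU : γ ∈ U.comap (Algebra.TensorProduct.includeRight : Γ →ₐ[R] FractionAlgebra R Γ) := by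
    rw [TwoSidedIdeal.mem_comap, Algebra.TensorProduct.includeRight_apply, ← hγ,
      show r • a = algebraMap R (FractionAlgebra R Γ) r * a from Algebra.smul_def r a]
    exact U.mul_mem_left _ _ ha
  have hγ0 : γ ≠ 0 := by
    rintro rfl
    rw [TensorProduct.tmul_zero] at hγ
    exact ha0 (smul_fractionAlgebra_injective hr (hγ.trans (smul_zero r).symm))
  obtain ⟨s, hs, hsU⟩ := h.exists_algebraMap_mem _ ⟨γ, hγU, hγ0⟩
  rw [TwoSidedIdeal.mem_comap, AlgHom.commutes] at hsU
  have : (algebraMap (FractionRing R) (FractionAlgebra R Γ) (algebraMap R _ s)⁻¹) *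
      algebraMap R (FractionAlgebra R Γ) s = 1 := by
    rw [IsScalarTower.algebraMap_apply R (FractionRing R) (FractionAlgebra R Γ), ← map_mul,
      inv_mul_cancel₀ ((FaithfulSMul.algebraMap_eq_zero_iff R (FractionRing R)).not.2 hs),
      map_one]
  rw [← this]
  exact U.mul_mem_left _ _ hsU

end PrimeOrder

/-! ### Localization at a height one prime -/

section CodimOne

variable {R : Type u} [CommRing R] [IsDomain R] {Γ : Type v} [Ring Γ] [Algebra R Γ]
  (p : Ideal R) [p.IsPrime]

variable (Γ) in
/-- The localization `Γ_p` as an order in `K ⊗ Γ`. -/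
noncomputable def localOrder : Subalgebra (Localization.AtPrime p) (FractionAlgebra R Γ) :=
  (Algebra.TensorProduct.map (Algebra.ofId (Localization.AtPrime p) (FractionRing R))
    (AlgHom.id R Γ)).range

theorem mem_localOrder {x : FractionAlgebra R Γ} :
    x ∈ localOrder Γ p ↔ ∃ s ∉ p, ∃ γ : Γ, s • x = 1 ⊗ₜ γ := by
  constructor
  · rintro ⟨z, rfl⟩
    obtain ⟨⟨γ, s⟩, h⟩ := IsLocalizedModule.surj p.primeCompl
      (TensorProduct.mk R (Localization.AtPrime p) Γ 1) z
    refine ⟨s, s.2, γ, ?_⟩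
    have h' : algebraMap R (Localization.AtPrime p) s • z = 1 ⊗ₜ γ := by
      rw [algebraMap_smul]
      exact h
    rw [← algebraMap_smul (Localization.AtPrime p), AlgHom.toRingHom_eq_coe, RingHom.coe_coe,
      ← map_smul, h', Algebra.TensorProduct.map_tmul, map_one, AlgHom.id_apply]
  · rintro ⟨s, hs, γ, h⟩
    obtain ⟨c, hc⟩ : ∃ c, c * algebraMap R (Localization.AtPrime p) s = 1 :=
      (IsLocalization.map_units (Localization.AtPrime p) (⟨s, hs⟩ : p.primeCompl)).exists_left_inv
    refine ⟨c ⊗ₜ γ, ?_⟩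
    have : x = c • (1 ⊗ₜ γ : FractionAlgebra R Γ) := by
      rw [← h, ← algebraMap_smul (Localization.AtPrime p) s x, smul_smul, hc, one_smul]
    rw [this, AlgHom.toRingHom_eq_coe, RingHom.coe_coe, Algebra.TensorProduct.map_tmul,
      TensorProduct.smul_tmul', Algebra.ofId_apply, Algebra.algebraMap_eq_smul_one, AlgHom.id_apply]

theorem one_tmul_mem_localOrder (γ : Γ) : (1 ⊗ₜ γ : FractionAlgebra R Γ) ∈ localOrder Γ p :=
  (mem_localOrder p).2 ⟨1, p.primeCompl.one_mem, γ, one_smul _ _⟩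

theorem localOrder_fg [Module.Finite R Γ] :
    (Subalgebra.toSubmodule (localOrder Γ p)).FG := by
  exact Module.Finite.iff_fg.1 (Module.Finite.range (Algebra.TensorProduct.map
    (Algebra.ofId (Localization.AtPrime p) (FractionRing R)) (AlgHom.id R Γ)).toLinearMap)

theorem exists_smul_mem_localOrder {M : Submodule (Localization.AtPrime p) (FractionAlgebra R Γ)}
    (hM : M.FG) : ∃ r : R, r ≠ 0 ∧
      ∀ m ∈ M, algebraMap R (Localization.AtPrime p) r • m ∈ localOrder Γ p := by
  induction M, hM using Submodule.fg_induction with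
  | singleton x =>
    obtain ⟨r, hr, γ, h⟩ := exists_smul_eq_one_tmul x
    refine ⟨r, hr, fun m hm => ?_⟩
    obtain ⟨c, rfl⟩ := Submodule.mem_span_singleton.1 hm
    rw [smul_comm, algebraMap_smul, h]
    exact Subalgebra.smul_mem _ (one_tmul_mem_localOrder p γ) c
  | sup M N hM hN ihM ihN =>
    obtain ⟨r, hr, h⟩ := ihM
    obtain ⟨s, hs, h'⟩ := ihN
    refine ⟨r * s, mul_ne_zero hr hs, fun m hm => ?_⟩
    obtain ⟨x, hx, y, hy, rfl⟩ := Submodule.mem_sup.1 hm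
    rw [smul_add, map_mul]
    refine add_mem ?_ ?_
    · rw [mul_comm, mul_smul]
      exact Subalgebra.smul_mem _ (h x hx) _
    · rw [mul_smul]
      exact Subalgebra.smul_mem _ (h' y hy) _

variable (htf : ∀ (r : R) (γ : Γ), r • γ = 0 → r = 0 ∨ γ = 0)
include htf

theorem exists_eq_algebraMap_of_mem_localOrder [Algebra.IsCentral R Γ] {x : FractionAlgebra R Γ}
    (hx : x ∈ localOrder Γ p) (h : ∀ y ∈ localOrder Γ p, x * y = y * x) :
    ∃ r : Localization.AtPrime p, x = algebraMap _ _ r := by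
  obtain ⟨s, hs, γ, hγ⟩ := (mem_localOrder p).1 hx
  have hγc : γ ∈ Subalgebra.center R Γ := by
    rw [Subalgebra.mem_center_iff]
    intro b
    have h1 : (1 ⊗ₜ b) * (s • x) = (s • x) * (1 ⊗ₜ b) := by
      rw [mul_smul_comm, smul_mul_assoc, h _ (one_tmul_mem_localOrder p b)]
    rw [hγ, Algebra.TensorProduct.tmul_mul_tmul, Algebra.TensorProduct.tmul_mul_tmul] at h1
    exact one_tmul_injective htf (by simpa using h1)
  obtain ⟨c, hc⟩ := (Algebra.IsCentral.mem_center_iff R).1 hγc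
  have hs0 : s ≠ 0 := fun h0 => hs (h0 ▸ p.zero_mem)
  let s' : p.primeCompl := ⟨s, hs⟩
  refine ⟨IsLocalization.mk' _ c s', ?_⟩
  apply smul_fractionAlgebra_injective hs0
  have e (u v : Localization.AtPrime p) :
      u • algebraMap _ (FractionAlgebra R Γ) v = algebraMap _ (FractionAlgebra R Γ) (u * v) :=
    (LinearMap.map_smul (Algebra.linearMap (Localization.AtPrime p) (FractionAlgebra R Γ)) u v).symm
  rw [hγ, hc, ← algebraMap_smul (Localization.AtPrime p) s (algebraMap _ _ _)]
  refine Eq.trans ?_ (e _ _).symm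
  rw [IsLocalization.mk'_spec' (Localization.AtPrime p) c s', ← IsScalarTower.algebraMap_apply]
  exact (Algebra.TensorProduct.includeRight : Γ →ₐ[R] FractionAlgebra R Γ).commutes c

theorem localOrder_hasDualBases (hΓ : IsHereditaryRing (Γ ⊗[R] Localization.AtPrime p)) :
    HasDualBases (localOrder Γ p) := by
  let φ := Algebra.TensorProduct.map (Algebra.ofId (Localization.AtPrime p) (FractionRing R))
    (AlgHom.id R Γ)
  have hφ : Function.Injective φ := by
    rw [injective_iff_map_eq_zero]
    intro z hz
    obtain ⟨⟨γ, s⟩, h⟩ := IsLocalizedModule.surj p.primeCompl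
      (TensorProduct.mk R (Localization.AtPrime p) Γ 1) z
    have h' : algebraMap R (Localization.AtPrime p) s • z = 1 ⊗ₜ γ := by
      rw [algebraMap_smul]
      exact h
    have hγ : γ = 0 := by
      apply one_tmul_injective htf
      rw [TensorProduct.tmul_zero]
      have := congrArg φ h'
      rw [map_smul, hz, smul_zero, Algebra.TensorProduct.map_tmul, map_one, AlgHom.id_apply] at this
      exact this.symm
    rw [hγ, TensorProduct.tmul_zero] at h'
    exact (IsLocalization.map_units (Localization.AtPrime p) s).smul_eq_zero.1 h'
  -- Heredity is assumed for Γ ⊗ R_p, while the order is the image of R_p ⊗ Γ; the commutativity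
  -- isomorphism passes between them.
  refine hasDualBases_of_hereditary hΓ (φ.toRingHom.comp
    (Algebra.TensorProduct.comm R Γ (Localization.AtPrime p)).toRingHom) ?_ ?_ ?_
  · exact hφ.comp (Algebra.TensorProduct.comm R Γ (Localization.AtPrime p)).injective
  · intro x
    constructor
    · rintro ⟨z, rfl⟩
      refine ⟨(Algebra.TensorProduct.comm R Γ (Localization.AtPrime p)).symm z, ?_⟩
      exact congrArg φ (AlgEquiv.apply_symm_apply _ z)
    · rintro ⟨z, rfl⟩
      exact ⟨_, rfl⟩
  · intro M hM
    obtain ⟨r, hr, h⟩ := exists_smul_mem_localOrder p hM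
    refine ⟨algebraMap R _ r, ?_, h⟩
    rw [IsScalarTower.algebraMap_apply (Localization.AtPrime p) (FractionRing R),
      ← IsScalarTower.algebraMap_apply R]
    exact (isUnit_iff_ne_zero.2
      ((FaithfulSMul.algebraMap_eq_zero_iff R (FractionRing R)).not.2 hr)).map _

/-- An element of norm one normalizing an order which is hereditary at `p` lies in the
localized order. -/
theorem mem_localOrder_of_normalizing [IsNoetherianRing R] [IsIntegrallyClosed R]
    [Module.Finite R Γ] [Algebra.IsCentral R Γ] [Nontrivial (FractionAlgebra R Γ)]
    (hp : p.height = 1) (hΓ : IsHereditaryRing (Γ ⊗[R] Localization.AtPrime p))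
    (a : (FractionAlgebra R Γ)ˣ) (h1 : ∀ γ : Γ, ∃ γ' : Γ,
      (a : FractionAlgebra R Γ) * 1 ⊗ₜ γ * (↑a⁻¹ : FractionAlgebra R Γ) = 1 ⊗ₜ γ')
    (h2 : ∀ γ : Γ, ∃ γ' : Γ,
      (↑a⁻¹ : FractionAlgebra R Γ) * 1 ⊗ₜ γ * (a : FractionAlgebra R Γ) = 1 ⊗ₜ γ')
    (hn : Algebra.norm (FractionRing R) (a : FractionAlgebra R Γ) = 1) :
    (a : FractionAlgebra R Γ) ∈ localOrder Γ p := by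
  obtain ⟨π, hπ0, hπ⟩ := exists_maximalIdeal_localization_eq_span R p hp
  have : IsPrincipalIdealRing (Localization.AtPrime p) :=
    ((tfae_of_isNoetherianRing_of_isLocalRing_of_isDomain (Localization.AtPrime p)).out
      4 0 rfl rfl).1 ⟨π, hπ⟩
  have hb (x : FractionAlgebra R Γ) : ∃ c : Localization.AtPrime p, c ≠ 0 ∧
      c • x ∈ localOrder Γ p := by
    obtain ⟨r, hr, γ, hγ⟩ := exists_smul_eq_one_tmul x
    refine ⟨algebraMap R _ r, (FaithfulSMul.algebraMap_eq_zero_iff R _).not.2 hr, ?_⟩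
    rw [algebraMap_smul, hγ]
    exact one_tmul_mem_localOrder p γ
  have key (b c : FractionAlgebra R Γ) (h : ∀ γ : Γ, ∃ γ' : Γ, b * 1 ⊗ₜ γ * c = 1 ⊗ₜ γ') :
      ∀ g ∈ localOrder Γ p, b * g * c ∈ localOrder Γ p := by
    intro g hg
    obtain ⟨s, hs, γ, hγ⟩ := (mem_localOrder p).1 hg
    obtain ⟨γ', hγ'⟩ := h γ
    exact (mem_localOrder p).2 ⟨s, hs, γ', by rw [← hγ', ← hγ, mul_smul_comm, smul_mul_assoc]⟩
  have hπ' : algebraMap (Localization.AtPrime p) (FractionAlgebra R Γ) π *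
      algebraMap (FractionRing R) _ (algebraMap _ (FractionRing R) π)⁻¹ = 1 := by
    rw [IsScalarTower.algebraMap_apply _ (FractionRing R) (FractionAlgebra R Γ), ← map_mul,
      mul_inv_cancel₀ ((FaithfulSMul.algebraMap_eq_zero_iff _ (FractionRing R)).not.2 hπ0),
      map_one]
  rcases le_or_le_of_invertible hπ hπ' (localOrder_fg p)
    (fun x hx h => exists_eq_algebraMap_of_mem_localOrder p htf hx h)
    (localOrder_hasDualBases p htf hΓ)
    (isInversePair_span_unit_mul a (key _ _ h1) (key _ _ h2)) with h | h
  · refine h ?_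
    have := Submodule.mul_mem_mul (Submodule.mem_span_singleton_self (R := Localization.AtPrime p)
      (a : FractionAlgebra R Γ))
      (show (1 : FractionAlgebra R Γ) ∈ Subalgebra.toSubmodule (localOrder Γ p) from
        (localOrder Γ p).one_mem)
    rwa [mul_one] at this
  -- Here 1 ∈ aE, so a⁻¹ lies in the order. It has norm one, so its inverse `a` lies there too.
  · obtain ⟨g, hg, hg'⟩ := Submodule.mem_span_singleton_mul.1 (h (localOrder Γ p).one_mem)
    have hga : g = ↑a⁻¹ := by
      rw [← mul_one (↑a⁻¹ : FractionAlgebra R Γ), ← hg', Units.inv_mul_cancel_left]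
    have hn' : Algebra.norm (FractionRing R) g = 1 := by
      have := congrArg (Algebra.norm (FractionRing R)) hg'
      rwa [map_mul, hn, one_mul, map_one] at this
    obtain ⟨y, hy, hgy⟩ := exists_mul_eq_one_of_norm_eq_one (localOrder Γ p) (localOrder_fg p) hb
      hg hn'
    have : (a : FractionAlgebra R Γ) = y := by
      rw [← mul_one (a : FractionAlgebra R Γ), ← hgy, hga, Units.mul_inv_cancel_left]
    rwa [this]

end CodimOne

/-! ### Reflexive orders and codimension one -/

section Reflexive

variable {R : Type u} [CommRing R] [IsDomain R] [IsNoetherianRing R] [IsIntegrallyClosed R]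
  {Γ : Type v} [Ring Γ] [Algebra R Γ]

/-- A reflexive order is the intersection of its localizations at the primes of height one. -/
theorem exists_eq_one_tmul_of_forall_mem_localOrder [Module.IsReflexive R Γ]
    (x : FractionAlgebra R Γ)
    (h : ∀ (p : Ideal R) [p.IsPrime], p.height = 1 → x ∈ localOrder Γ p) :
    ∃ γ : Γ, x = 1 ⊗ₜ γ := by
  -- A functional on `Γ` extends to K ⊗ Γ. Its value at `x` lies in every R_p of height one, hence
  -- in `R`; so `x` defines an element of the bidual, which reflexivity realizes in `Γ`.
  let ev (f : Module.Dual R Γ) : FractionAlgebra R Γ →ₗ[R] FractionRing R :=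
    TensorProduct.lift ((LinearMap.lsmul R (FractionRing R)).flip.compl₂ f)
  have hev (f : Module.Dual R Γ) (γ : Γ) : ev f (1 ⊗ₜ γ) = algebraMap R _ (f γ) := by
    simp [ev, Algebra.algebraMap_eq_smul_one]
  have hex (f : Module.Dual R Γ) : ∃ r, ev f x = algebraMap R _ r := by
    refine mem_range_algebraMap_of_forall_height_one _ fun p _ hp => ?_
    obtain ⟨s, hs, γ, hγ⟩ := (mem_localOrder p).1 (h p hp)
    exact ⟨s, hs, f γ, by rw [← map_smul, hγ, hev]⟩
  choose F hF using hex
  obtain ⟨r, hr, z, hz⟩ := exists_smul_eq_one_tmul x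
  have hinj := IsFractionRing.injective R (FractionRing R)
  have hFz (f : Module.Dual R Γ) : r * F f = f z := by
    apply hinj
    rw [map_mul, ← hF, ← Algebra.smul_def, ← map_smul, hz, hev]
  let Φ : Module.Dual R (Module.Dual R Γ) :=
    { toFun := F
      map_add' := fun f g => mul_left_cancel₀ hr (by
        rw [mul_add, hFz, hFz, hFz, LinearMap.add_apply])
      map_smul' := fun c f => mul_left_cancel₀ hr (by
        rw [RingHom.id_apply, smul_eq_mul, mul_left_comm, hFz, hFz, LinearMap.smul_apply,
          smul_eq_mul]) }
  obtain ⟨y, hy⟩ := (Module.bijective_dual_eval R Γ).2 Φ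
  refine ⟨y, smul_fractionAlgebra_injective hr ?_⟩
  have : r • y = z := by
    apply (Module.bijective_dual_eval R Γ).1
    ext f
    rw [Module.Dual.eval_apply, Module.Dual.eval_apply, map_smul, ← hFz, smul_eq_mul,
      ← Module.Dual.eval_apply, hy]
    rfl
  rw [hz, ← this, TensorProduct.tmul_smul]

end Reflexive

/-! ### Bimodules as fractional ideals -/

namespace BalancedTensor

variable {S : Type v} [Ring S] {M N : Type v} [AddCommGroup M] [AddCommGroup N]
  [Module Sᵐᵒᵖ M] [Module S N] {X : Type*} [AddCommGroup X]

/-- A balanced biadditive map induces an additive map on `M ⊗_S N`. -/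
def lift (b : M →+ N →+ X) (hb : ∀ m (s : S) n, b (MulOpposite.op s • m) n = b m (s • n)) :
    BalancedTensor S M N →+ X :=
  QuotientAddGroup.lift (balancedRel S M N) (TensorProduct.liftAddHom b (fun c m n => by simp)) (by
    rw [balancedRel, AddSubgroup.closure_le]
    rintro _ ⟨m, s, n, rfl⟩
    exact (map_sub _ _ _).trans (sub_eq_zero.2 (hb m s n)))

theorem lift_tmul (b : M →+ N →+ X)
    (hb : ∀ m (s : S) n, b (MulOpposite.op s • m) n = b m (s • n)) (m : M) (n : N) :
    lift b hb (tmul S m n) = b m n := rfl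

/-- The map `n ↦ m ⊗ n`. -/
def tmulHom (m : M) : N →+ BalancedTensor S M N where
  toFun := tmul S m
  map_zero' := tmul_zero S m
  map_add' := tmul_add S m

end BalancedTensor

namespace Bimodule

variable {S : Type v} [Ring S]

/-- An embedding of a bimodule over `S` in a ring extension of `S`. -/
structure IsEmbedding {A : Type*} [Ring A] (e : S →+* A) (M : Bimodule S) (α : M.carrier →+ A) :
    Prop where
  injective : Function.Injective α
  map_smul : ∀ s m, α (s • m) = e s * α m
  map_op_smul : ∀ s m, α (MulOpposite.op s • m) = α m * e s

theorem IsEmbedding.isomorphic {A : Type*} [Ring A] {e : S →+* A} {M N : Bimodule S}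
    {α : M.carrier →+ A} {β : N.carrier →+ A} (hα : IsEmbedding e M α) (hβ : IsEmbedding e N β)
    (h : Set.range α = Set.range β) : M.Isomorphic N := by
  have h1 (m : M.carrier) : ∃ n, β n = α m := h.le (Set.mem_range_self m)
  have h2 (n : N.carrier) : ∃ m, α m = β n := h.ge (Set.mem_range_self n)
  choose f hf using h1
  choose g hg using h2
  refine ⟨{ toFun := f, invFun := g, left_inv := fun m => hα.injective (by rw [hg, hf]),
            right_inv := fun n => hβ.injective (by rw [hf, hg]),
            map_add' := fun m m' => hβ.injective (by rw [hf, map_add, map_add, hf, hf]) },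
    fun s m => hβ.injective ?_, fun s m => hβ.injective ?_⟩
  · exact (hf _).trans (by rw [hα.map_smul, hβ.map_smul]; exact congrArg _ (hf m).symm)
  · exact (hf _).trans (by rw [hα.map_op_smul, hβ.map_op_smul]; exact congrArg (· * _) (hf m).symm)

/-- If `θ(P) J ⊆ S` and `1 ∈ J θ(P)`, then multiplication embeds `M ⊗_S P`. -/
theorem IsEmbedding.tensor {A : Type*} [Ring A] {e : S →+* A} {M P : Bimodule S}
    {α : M.carrier →+ A} {θ : P.carrier →+ A} (hα : IsEmbedding e M α) (hθ : IsEmbedding e P θ)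
    (J : Set A) (hJ : ∀ p, ∀ y ∈ J, ∃ s, e s = θ p * y) (l : List (J × P.carrier))
    (hl : (l.map fun c => c.1.1 * θ c.2).sum = 1) :
    ∃ μ : (M.tensor P).carrier →+ A, IsEmbedding e (M.tensor P) μ ∧
      ∀ m p, μ (BalancedTensor.tmul S m p) = α m * θ p := by
  let b : M.carrier →+ P.carrier →+ A := (AddMonoidHom.mul.comp α).compl₂ θ
  let μ : (M.tensor P).carrier →+ A := BalancedTensor.lift b fun m s p => by
    change α _ * θ _ = α _ * θ _
    rw [hα.map_op_smul, hθ.map_smul, mul_assoc]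
  have hμ (m p) : μ (BalancedTensor.tmul S m p) = α m * θ p := rfl
  have hW (y : J) (t : (M.tensor P).carrier) : ∃ w, α w = μ t * y := by
    induction t using BalancedTensor.induction_on with
    | zero => exact ⟨0, by rw [map_zero, map_zero, zero_mul]⟩
    | tmul m p =>
      obtain ⟨s, hs⟩ := hJ p y y.2
      exact ⟨MulOpposite.op s • m, by rw [hα.map_op_smul, hμ, hs, mul_assoc]⟩
    | add t t' ht ht' =>
      obtain ⟨w, hw⟩ := ht
      obtain ⟨w', hw'⟩ := ht'
      exact ⟨w + w', by rw [map_add, hw, hw', map_add, add_mul]⟩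
  choose W hW using hW
  -- With 1 = ∑ yᵢ θ(pᵢ), each `t` equals ∑ W(yᵢ, t) ⊗ pᵢ, and W(yᵢ, t) depends only on `μ t`. So
  -- `μ` is injective.
  have key (t : (M.tensor P).carrier) :
      (l.map fun c => BalancedTensor.tmul S (W c.1 t) c.2).sum = t := by
    induction t using BalancedTensor.induction_on with
    | zero =>
      have h0 (y : J) : W y 0 = 0 := hα.injective (by rw [hW, map_zero, map_zero, zero_mul])
      simp only [h0, BalancedTensor.zero_tmul]
      simp
    | tmul m p =>
      choose! s hs using hJ p
      have h1 (y : J) : W y (BalancedTensor.tmul S m p) = MulOpposite.op (s y) • m :=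
        hα.injective (by rw [hW, hμ, hα.map_op_smul, hs y y.2, mul_assoc])
      simp only [h1, BalancedTensor.smul_tmul]
      have h2 : (l.map fun c => s c.1 • c.2).sum = p := by
        apply hθ.injective
        rw [map_list_sum, List.map_map]
        have : (θ ∘ fun c : J × P.carrier => s c.1 • c.2) =
            fun c => θ p * (c.1.1 * θ c.2) := by
          funext c
          rw [Function.comp_apply, hθ.map_smul, hs c.1 c.1.2, mul_assoc]
        rw [this, List.sum_map_mul_left, hl, mul_one]
      have h3 := map_list_sum (BalancedTensor.tmulHom (S := S) m) (l.map fun c => s c.1 • c.2)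
      rw [h2, List.map_map] at h3
      exact h3.symm
    | add t t' ht ht' =>
      have h1 (y : J) : W y (t + t') = W y t + W y t' :=
        hα.injective (by rw [hW, map_add, map_add, hW, hW, add_mul])
      simp only [h1, BalancedTensor.add_tmul]
      rw [List.sum_map_add, ht, ht']
  refine ⟨μ, ⟨?_, ?_, ?_⟩, hμ⟩
  · rw [injective_iff_map_eq_zero]
    intro t ht
    have h0 (y : J) : W y t = 0 := hα.injective (by rw [hW, ht, map_zero, zero_mul])
    rw [← key t]
    simp only [h0, BalancedTensor.zero_tmul]
    simp
  · intro s t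
    induction t using BalancedTensor.induction_on with
    | zero => rw [smul_zero, map_zero, mul_zero]
    | tmul m p => rw [BalancedTensor.left_smul_tmul, hμ, hμ, hα.map_smul, mul_assoc]
    | add t t' ht ht' => rw [smul_add, map_add, map_add, mul_add, ht, ht']
  · intro s t
    induction t using BalancedTensor.induction_on with
    | zero => rw [smul_zero, map_zero, zero_mul]
    | tmul m p => rw [BalancedTensor.right_smul_tmul, hμ, hμ, hθ.map_op_smul, mul_assoc]
    | add t t' ht ht' => rw [smul_add, map_add, map_add, add_mul, ht, ht']

/-- The central factor `d` allows a scalar multiple of the order to be recognized as the regular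
bimodule. -/
theorem isEmbedding_regular {A : Type*} [Ring A] {e : S →+* A} (he : Function.Injective e) {d : A}
    (hd : IsUnit d) (hc : ∀ a, d * a = a * d) :
    IsEmbedding e (regular S) ((AddMonoidHom.mulRight d).comp e.toAddMonoidHom) where
  injective s t h := he (hd.mul_right_cancel h)
  map_smul s t := by
    change e (s * t) * d = e s * (e t * d)
    rw [map_mul, mul_assoc]
  map_op_smul s t := by
    change e (t * s) * d = e t * d * e s
    rw [map_mul, mul_assoc, mul_assoc, hc]

/-- The tensor powers of an invertible fractional ideal are its powers. -/
theorem IsEmbedding.tensorPow {O A : Type*} [CommRing O] [Ring A] [Algebra O A] [Algebra O S]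
    {e : S →ₐ[O] A} (he : Function.Injective e) {P : Bimodule S} {θ : P.carrier →+ A}
    (hθ : IsEmbedding e.toRingHom P θ) {I J : Submodule O A} (hI : Set.range θ = I)
    (h : IsInversePair (Subalgebra.toSubmodule e.range) I J) (n : ℕ) :
    ∃ α : (P.tensorPow n).carrier →+ A, IsEmbedding e.toRingHom (P.tensorPow n) α ∧
      Set.range α = (Subalgebra.toSubmodule e.range * I ^ n : Submodule O A) := by
  have hl : ∀ a ∈ J * I, ∃ l : List (Set.Elem (J : Set A) × P.carrier),
      (l.map fun c => c.1.1 * θ c.2).sum = a := by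
    intro a ha
    induction ha using Submodule.mul_induction_on' with
    | mem_mul_mem y hy x hx =>
      obtain ⟨p, rfl⟩ := hI.ge hx
      exact ⟨[(⟨y, hy⟩, p)], by simp⟩
    | add x _ y _ hx hy =>
      obtain ⟨l, rfl⟩ := hx
      obtain ⟨l', rfl⟩ := hy
      exact ⟨l ++ l', by simp⟩
  obtain ⟨l, hl⟩ := hl 1 (h.inv_mul ▸ e.range.one_mem)
  induction n with
  | zero =>
    refine ⟨_, isEmbedding_regular he isUnit_one fun a => by rw [one_mul, mul_one], ?_⟩
    rw [pow_zero, mul_one]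
    ext a
    constructor
    · rintro ⟨s, rfl⟩
      exact ⟨s, (mul_one _).symm⟩
    · rintro ⟨s, rfl⟩
      exact ⟨s, mul_one _⟩
  | succ n ih =>
    obtain ⟨α, hα, hr⟩ := ih
    obtain ⟨μ, hμ, hμt⟩ := hα.tensor hθ J (fun p y hy => by
      have : θ p * y ∈ I * J := Submodule.mul_mem_mul (hI.le (Set.mem_range_self p)) hy
      rw [h.mul_inv] at this
      exact this) l hl
    have hr' : Set.range μ = (Subalgebra.toSubmodule e.range * I ^ n * I : Submodule O A) := ?_
    · rw [mul_assoc, ← pow_succ] at hr'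
      exact ⟨μ, hμ, hr'⟩
    apply Set.Subset.antisymm
    · rintro _ ⟨t, rfl⟩
      induction t using BalancedTensor.induction_on with
      | zero => rw [map_zero]; exact zero_mem _
      | tmul m p =>
        rw [hμt]
        exact Submodule.mul_mem_mul (hr.le (Set.mem_range_self m)) (hI.le (Set.mem_range_self p))
      | add t t' ht ht' => rw [map_add]; exact add_mem ht ht'
    · intro a ha
      induction ha using Submodule.mul_induction_on' with
      | mem_mul_mem x hx y hy =>
        obtain ⟨m, rfl⟩ := hr.ge hx
        obtain ⟨p, rfl⟩ := hI.ge hy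
        exact ⟨_, hμt m p⟩
      | add x _ y _ hx hy =>
        obtain ⟨t, rfl⟩ := hx
        obtain ⟨t', rfl⟩ := hy
        exact ⟨t + t', map_add _ _ _⟩

end Bimodule

/-- Because I J = E, the product J I is idempotent. Hence U E = U² E, and cancelling the invertible
`U` gives U E = E. -/
theorem IsInversePair.of_inv_mul_eq_central_mul {M : Type*} [Monoid M] {E I J U V : M}
    (hl : E * I = I) (hr : I * E = I) (hl' : E * J = J) (hr' : J * E = J) (hIJ : I * J = E)
    (hJI : J * I = U * E) (hE : E * E = E) (hU : ∀ x, U * x = x * U) (hUV : U * V = 1) :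
    IsInversePair E I J := by
  refine ⟨hl, hr, hl', hr', hIJ, ?_⟩
  have h1 : U * E = U * (U * E) := by
    calc U * E = J * I * (J * I) := by rw [mul_assoc, ← mul_assoc I, hIJ, hl, hJI]
      _ = U * (U * E) := by rw [hJI, mul_assoc, ← mul_assoc E, ← hU E, mul_assoc, hE]
  have h2 : V * U = 1 := by rw [← hU, hUV]
  calc J * I = V * U * (U * E) := by rw [h2, one_mul, hJI]
    _ = E := by rw [mul_assoc, ← h1, ← mul_assoc, h2, one_mul]

/-! ### Invertible bimodules over a prime order -/

namespace Bimodule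

section Invertible

variable {S : Type v} [Ring S] {P Q : Bimodule S}

/-- For fixed `q`, the element g(q ⊗ p)·y depends additively on p ⊗ y alone. If all p ⊗ y vanish,
then the image of `g`, which is all of `S`, kills `y`. -/
theorem eq_zero_of_forall_tmul_left (h : (Q.tensor P).Isomorphic (regular S)) {y : Q.carrier}
    (hy : ∀ p : P.carrier, BalancedTensor.tmul S p y = 0) : y = 0 := by
  obtain ⟨g, hg, hg'⟩ := h
  have h1 (q : Q.carrier) (p : P.carrier) : g (BalancedTensor.tmul S q p) • y = 0 := by
    let b : P.carrier →+ Q.carrier →+ Q.carrier :=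
      (AddMonoidHom.smul : S →+ Q.carrier →+ Q.carrier).comp
        (g.toAddMonoidHom.comp (BalancedTensor.tmulHom q))
    let m := BalancedTensor.lift (S := S) b fun p s y => by
      change g (BalancedTensor.tmul S q (MulOpposite.op s • p)) • y =
        g (BalancedTensor.tmul S q p) • s • y
      rw [← BalancedTensor.right_smul_tmul, hg', smul_smul]
      rfl
    exact (BalancedTensor.lift_tmul b _ p y).symm.trans ((congrArg m (hy p)).trans (map_zero m))
  have h2 (t : (Q.tensor P).carrier) : g t • y = 0 := by
    induction t using BalancedTensor.induction_on with
    | zero => rw [map_zero]; exact zero_smul S y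
    | tmul q p => exact h1 q p
    | add t t' ht ht' =>
      rw [map_add]
      exact (add_smul (g t) (g t') y).trans (by rw [ht, ht', add_zero])
  have h3 := h2 (g.symm (1 : S))
  rw [g.apply_symm_apply] at h3
  exact (one_smul S y).symm.trans h3

theorem eq_zero_of_forall_tmul_right (h : (Q.tensor P).Isomorphic (regular S)) {x : P.carrier}
    (hx : ∀ q : Q.carrier, BalancedTensor.tmul S x q = 0) : x = 0 := by
  obtain ⟨g, hg, hg'⟩ := h
  have h1 (q : Q.carrier) (p : P.carrier) :
      MulOpposite.op (g (BalancedTensor.tmul S q p)) • x = 0 := by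
    let b : P.carrier →+ Q.carrier →+ P.carrier :=
      AddMonoidHom.flip ((AddMonoidHom.smul : Sᵐᵒᵖ →+ P.carrier →+ P.carrier).comp
        (MulOpposite.opAddEquiv.toAddMonoidHom.comp (g.toAddMonoidHom.comp
          (AddMonoidHom.mk' (fun q => BalancedTensor.tmul S q p)
            fun q q' => BalancedTensor.add_tmul S q q' p))))
    let m := BalancedTensor.lift (S := S) b fun x s q => by
      change MulOpposite.op (g (BalancedTensor.tmul S q p)) • MulOpposite.op s • x =
        MulOpposite.op (g (BalancedTensor.tmul S (s • q) p)) • x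
      rw [← BalancedTensor.left_smul_tmul, hg, smul_smul]
      rfl
    exact (BalancedTensor.lift_tmul b _ x q).symm.trans ((congrArg m (hx q)).trans (map_zero m))
  have h2 (t : (Q.tensor P).carrier) : MulOpposite.op (g t) • x = 0 := by
    induction t using BalancedTensor.induction_on with
    | zero => rw [map_zero]; exact zero_smul Sᵐᵒᵖ x
    | tmul q p => exact h1 q p
    | add t t' ht ht' =>
      rw [map_add]
      exact (add_smul (MulOpposite.op (g t)) (MulOpposite.op (g t')) x).trans
        (by rw [ht, ht', add_zero])
  have h3 := h2 (g.symm (1 : S))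
  rw [g.apply_symm_apply] at h3
  exact (one_smul Sᵐᵒᵖ x).symm.trans h3

variable {R : Type u} [CommRing R] [Algebra R S]

/-- The difference r q - q r is tested in Q ⊗ P: there `r` passes from `q` across `p`, by centrality
of `P`, to the right end, and on `S` both ends agree. -/
theorem IsCentralOver.of_inverse (h : (Q.tensor P).Isomorphic (regular S))
    (h' : (P.tensor Q).Isomorphic (regular S)) (hP : P.IsCentralOver R) : Q.IsCentralOver R := by
  intro r q
  rw [← sub_eq_zero]
  apply eq_zero_of_forall_tmul_right h'
  obtain ⟨g, hg, hg'⟩ := h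
  intro p
  apply g.injective
  have : BalancedTensor.tmul S (algebraMap R S r • q - MulOpposite.op (algebraMap R S r) • q) p =
      BalancedTensor.tmul S (algebraMap R S r • q) p -
        BalancedTensor.tmul S (MulOpposite.op (algebraMap R S r) • q) p :=
    map_sub (AddMonoidHom.mk' (fun q => BalancedTensor.tmul S q p)
      fun q q' => BalancedTensor.add_tmul S q q' p) _ _
  rw [this, map_zero, map_sub, sub_eq_zero, BalancedTensor.smul_tmul, hP,
    ← BalancedTensor.left_smul_tmul, ← BalancedTensor.right_smul_tmul, hg, hg']
  exact Algebra.commutes r (g _ : S)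

theorem eq_zero_of_smul_eq_zero (h : (Q.tensor P).Isomorphic (regular S))
    (h' : (P.tensor Q).Isomorphic (regular S))
    (htf : ∀ (r : R) (s : S), r • s = 0 → r = 0 ∨ s = 0) (r : R) (x : P.carrier)
    (hx : algebraMap R S r • x = 0) : r = 0 ∨ x = 0 := by
  rw [or_iff_not_imp_left]
  intro hr
  apply eq_zero_of_forall_tmul_right h
  obtain ⟨f, hf, hf'⟩ := h'
  intro q
  apply f.injective
  rw [map_zero]
  refine (htf r (f (BalancedTensor.tmul S x q)) ?_).resolve_left hr
  rw [Algebra.smul_def]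
  refine (hf _ _).symm.trans ?_
  rw [BalancedTensor.left_smul_tmul, hx, BalancedTensor.zero_tmul, map_zero]

/-- Every endomorphism of the regular bimodule is multiplication by a scalar. -/
theorem exists_eq_algebraMap_mul [Algebra.IsCentral R S] {N : Bimodule S}
    {f : N.carrier ≃+ S} (hf : ∀ (s : S) (m : N.carrier), f (s • m) = s * f m)
    (hf' : ∀ (s : S) (m : N.carrier), f (MulOpposite.op s • m) = f m * s)
    {φ : N.carrier →+ S} (hφ : ∀ (s : S) (m : N.carrier), φ (s • m) = s * φ m)
    (hφ' : ∀ (s : S) (m : N.carrier), φ (MulOpposite.op s • m) = φ m * s) :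
    ∃ r : R, ∀ m, φ m = algebraMap R S r * f m := by
  have h1 (m : N.carrier) : φ m = f m * φ (f.symm 1) := by
    rw [← hφ]
    congr 1
    apply f.injective
    rw [hf, f.apply_symm_apply, mul_one]
  have h2 (m : N.carrier) : φ m = φ (f.symm 1) * f m := by
    rw [← hφ']
    congr 1
    apply f.injective
    rw [hf', f.apply_symm_apply, one_mul]
  have hz : φ (f.symm 1) ∈ Subalgebra.center R S := by
    rw [Subalgebra.mem_center_iff]
    intro b
    have h := (h1 (f.symm b)).symm.trans (h2 (f.symm b))
    rwa [f.apply_symm_apply] at h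
  obtain ⟨r, hr⟩ := (Algebra.IsCentral.mem_center_iff R).1 hz
  exact ⟨r, fun m => hr ▸ h2 m⟩

theorem nontrivial_of_isomorphic_regular [Nontrivial S] (h : (P.tensor Q).Isomorphic (regular S)) :
    Nontrivial P.carrier := by
  by_contra hP
  rw [not_nontrivial_iff_subsingleton] at hP
  obtain ⟨f, -, -⟩ := h
  have h0 (t : (P.tensor Q).carrier) : t = 0 := by
    induction t using BalancedTensor.induction_on with
    | zero => rfl
    | tmul p q => rw [Subsingleton.elim p 0, BalancedTensor.zero_tmul]
    | add t t' ht ht' => rw [ht, ht', add_zero]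
  apply one_ne_zero (α := S)
  rw [← f.apply_symm_apply (1 : S), h0 (f.symm (1 : S))]
  exact map_zero f

/-- The product θ(p) ψ(q) defines a bimodule map P ⊗ Q → S, which is a central multiple of `f`. The
multiple is nonzero because `S` is prime. -/
theorem exists_mul_eq_algebraMap_mul [Algebra.IsCentral R S] (hS : IsPrimeRing S)
    {f : (P.tensor Q).carrier ≃+ S} (hf : ∀ (s : S) (m : (P.tensor Q).carrier), f (s • m) = s * f m)
    (hf' : ∀ (s : S) (m : (P.tensor Q).carrier), f (MulOpposite.op s • m) = f m * s)
    {θ : P.carrier →+ S} {ψ : Q.carrier →+ S} (hθ : ∀ s p, θ (s • p) = s * θ p)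
    (hθ' : ∀ s p, θ (MulOpposite.op s • p) = θ p * s) (hψ : ∀ s q, ψ (s • q) = s * ψ q)
    (hψ' : ∀ s q, ψ (MulOpposite.op s • q) = ψ q * s) (hθ0 : ∃ p, θ p ≠ 0) (hψ0 : ∃ q, ψ q ≠ 0) :
    ∃ r : R, r ≠ 0 ∧ ∀ p q, θ p * ψ q = algebraMap R S r * f (BalancedTensor.tmul S p q) := by
  let b : P.carrier →+ Q.carrier →+ S := (AddMonoidHom.mul.comp θ).compl₂ ψ
  let μ : (P.tensor Q).carrier →+ S := BalancedTensor.lift b fun p s q => by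
    change θ _ * ψ _ = θ _ * ψ _
    rw [hθ', hψ, mul_assoc]
  have hμ (p q) : μ (BalancedTensor.tmul S p q) = θ p * ψ q := rfl
  obtain ⟨r, hr⟩ := exists_eq_algebraMap_mul (R := R) hf hf' (φ := μ)
    (fun s t => by
      induction t using BalancedTensor.induction_on with
      | zero => rw [smul_zero, map_zero, mul_zero]
      | tmul p q => rw [BalancedTensor.left_smul_tmul, hμ, hμ, hθ, mul_assoc]
      | add t t' ht ht' => rw [smul_add, map_add, map_add, mul_add, ht, ht'])
    (fun s t => by
      induction t using BalancedTensor.induction_on with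
      | zero => rw [smul_zero, map_zero, zero_mul]
      | tmul p q => rw [BalancedTensor.right_smul_tmul, hμ, hμ, hψ', mul_assoc]
      | add t t' ht ht' => rw [smul_add, map_add, map_add, add_mul, ht, ht'])
  refine ⟨r, ?_, fun p q => hr (BalancedTensor.tmul S p q)⟩
  rintro rfl
  obtain ⟨p, hp⟩ := hθ0
  obtain ⟨q, hq⟩ := hψ0
  have h0 (s : S) : θ p * s * ψ q = 0 := by rw [← hθ', ← hμ, hr, map_zero, zero_mul]
  exact (hS.eq_zero_or_eq_zero (θ p) (ψ q) h0).elim hp hq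

theorem exists_submodule_eq_range {A : Type*} [Ring A] [Algebra R A] {e : S →ₐ[R] A}
    {φ : P.carrier →+ A} (h : ∀ s p, φ (s • p) = e s * φ p)
    (h' : ∀ s p, φ (MulOpposite.op s • p) = φ p * e s) :
    ∃ I : Submodule R A, Set.range φ = I ∧ Subalgebra.toSubmodule e.range * I = I ∧
      I * Subalgebra.toSubmodule e.range = I := by
  refine ⟨{ carrier := Set.range φ
            add_mem' := ?_
            zero_mem' := ⟨0, map_zero φ⟩
            smul_mem' := ?_ }, rfl, le_antisymm ?_ ?_, le_antisymm ?_ ?_⟩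
  · rintro _ _ ⟨p, rfl⟩ ⟨q, rfl⟩
    exact ⟨p + q, map_add φ p q⟩
  · rintro r _ ⟨p, rfl⟩
    exact ⟨algebraMap R S r • p, by rw [h, AlgHom.commutes, Algebra.smul_def]⟩
  · rw [Submodule.mul_le]
    rintro _ ⟨s, rfl⟩ _ ⟨p, rfl⟩
    exact ⟨s • p, h s p⟩
  · intro x hx
    rw [← one_mul x]
    exact Submodule.mul_mem_mul e.range.one_mem hx
  · rw [Submodule.mul_le]
    rintro _ ⟨p, rfl⟩ _ ⟨s, rfl⟩
    exact ⟨MulOpposite.op s • p, h' s p⟩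
  · intro x hx
    rw [← mul_one x]
    exact Submodule.mul_mem_mul hx e.range.one_mem

end Invertible

variable {R : Type u} [CommRing R] [IsDomain R] {Γ : Type v} [Ring Γ] [Algebra R Γ]

theorem exists_centralizing [Module.Finite R Γ] [IsSimpleRing (FractionAlgebra R Γ)]
    [Algebra.IsCentral (FractionRing R) (FractionAlgebra R Γ)] {M : Bimodule Γ}
    (hM : M.IsCentralOver R) [Nontrivial M.carrier]
    (htf : ∀ (r : R) (m : M.carrier), algebraMap R Γ r • m = 0 → r = 0 ∨ m = 0) :
    ∃ m : M.carrier, m ≠ 0 ∧ ∀ γ : Γ, γ • m = MulOpposite.op γ • m := by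
  -- `R` acts through the left action of `Γ`; centrality of `M` makes the right action compatible
  -- with it.
  let _ : Module R M.carrier := Module.compHom M.carrier (algebraMap R Γ)
  have hsm (r : R) (m : M.carrier) : r • m = algebraMap R Γ r • m := rfl
  have : IsScalarTower R Γ M.carrier :=
    ⟨fun r γ m => by rw [hsm, Algebra.smul_def, mul_smul]⟩
  have : IsScalarTower R Γᵐᵒᵖ M.carrier := ⟨fun r γ m => by
    change MulOpposite.op (r • γ.unop) • m = _
    rw [hsm, smul_comm (algebraMap R Γ r) γ m, hM, smul_smul, Algebra.smul_def,
      MulOpposite.op_mul, MulOpposite.op_unop]⟩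
  exact exists_centralizing_element (R := R) (Γ := Γ) (K := FractionRing R) htf

/-- An invertible central bimodule over a prime order is isomorphic to an invertible fractional
ideal. -/
theorem exists_isEmbedding_isInversePair {A₀ : Type w} [Ring A₀] {ι : Γ →+* A₀}
    (hΓ : IsPrimeOrder R ι) [Algebra.IsCentral R Γ] {P : Bimodule Γ} (hinv : P.IsInvertible)
    (hP : P.IsCentralOver R) :
    ∃ (θ : P.carrier →+ FractionAlgebra R Γ) (I J : Submodule R (FractionAlgebra R Γ)),
      IsEmbedding (Algebra.TensorProduct.includeRight : Γ →ₐ[R] FractionAlgebra R Γ).toRingHom P θ ∧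
      Set.range θ = I ∧
      IsInversePair (Subalgebra.toSubmodule
        (Algebra.TensorProduct.includeRight : Γ →ₐ[R] FractionAlgebra R Γ).range) I J := by
  have htf := hΓ.eq_zero_or_eq_zero_of_smul
  have := hΓ.finite
  have := hΓ.isSimpleRing_fractionAlgebra
  have := isCentral_fractionAlgebra htf
  have := hΓ.isPrimeRing.nontrivial
  obtain ⟨Q, hPQ, hQP⟩ := hinv
  have hQ := hP.of_inverse hQP hPQ
  have htP := eq_zero_of_smul_eq_zero hQP hPQ htf
  have htQ := eq_zero_of_smul_eq_zero hPQ hQP htf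
  have hf0 := hPQ
  have hg0 := hQP
  obtain ⟨f, hf, hf'⟩ := hPQ
  obtain ⟨g, hg, hg'⟩ := hQP
  have := nontrivial_of_isomorphic_regular hf0
  have := nontrivial_of_isomorphic_regular hg0
  obtain ⟨x, hx0, hx⟩ := exists_centralizing hP htP
  obtain ⟨y, hy0, hy⟩ := exists_centralizing hQ htQ
  -- Tensoring with the centralizing `y` or `x` and applying `f` gives bimodule maps from `P` and
  -- from `Q` to `Γ`.
  let θ : P.carrier →+ Γ := f.toAddMonoidHom.comp
    (AddMonoidHom.mk' (fun p => BalancedTensor.tmul Γ p y)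
      fun p p' => BalancedTensor.add_tmul Γ p p' y)
  let ψ : Q.carrier →+ Γ := f.toAddMonoidHom.comp (BalancedTensor.tmulHom x)
  have hθ (p) : θ p = f (BalancedTensor.tmul Γ p y) := rfl
  have hψ (q) : ψ q = f (BalancedTensor.tmul Γ x q) := rfl
  have hθl (γ p) : θ (γ • p) = γ * θ p := hf γ (BalancedTensor.tmul Γ p y)
  have hθr (γ p) : θ (MulOpposite.op γ • p) = θ p * γ := by
    rw [hθ, BalancedTensor.smul_tmul, hy]
    exact hf' γ (BalancedTensor.tmul Γ p y)
  have hψl (γ q) : ψ (γ • q) = γ * ψ q := by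
    rw [hψ, ← BalancedTensor.smul_tmul, ← hx]
    exact hf γ (BalancedTensor.tmul Γ x q)
  have hψr (γ q) : ψ (MulOpposite.op γ • q) = ψ q * γ :=
    hf' γ (BalancedTensor.tmul Γ x q)
  have hθ0 : ∃ p, θ p ≠ 0 := by
    by_contra! h
    exact hy0 (eq_zero_of_forall_tmul_left hg0 fun p =>
      f.injective ((h p).trans (map_zero f).symm))
  have hψ0 : ∃ q, ψ q ≠ 0 := by
    by_contra! h
    exact hx0 (eq_zero_of_forall_tmul_right hg0 fun q =>
      f.injective ((h q).trans (map_zero f).symm))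
  obtain ⟨r, hr, h1⟩ := exists_mul_eq_algebraMap_mul (R := R) hΓ.isPrimeRing hf hf' hθl hθr hψl hψr
    hθ0 hψ0
  obtain ⟨r', hr', h2⟩ := exists_mul_eq_algebraMap_mul (R := R) hΓ.isPrimeRing hg hg' hψl hψr
    hθl hθr hψ0 hθ0
  let e : Γ →ₐ[R] FractionAlgebra R Γ := Algebra.TensorProduct.includeRight
  let z (c : FractionRing R) : FractionAlgebra R Γ := algebraMap _ _ c
  have hz (c : FractionRing R) (a : FractionAlgebra R Γ) : z c * a = a * z c :=
    Algebra.commutes c a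
  have hez (r : R) : e (algebraMap R Γ r) = z (algebraMap R _ r) := by
    rw [AlgHom.commutes]
    exact IsScalarTower.algebraMap_apply R (FractionRing R) (FractionAlgebra R Γ) r
  have hK {r : R} (hr : r ≠ 0) : algebraMap R (FractionRing R) r ≠ 0 :=
    (FaithfulSMul.algebraMap_eq_zero_iff R (FractionRing R)).not.2 hr
  -- Dividing `ψ` by `r` makes θ'(p) ψ'(q) exactly f(p ⊗ q), so I J = E. The product J I then equals
  -- (r'/r) E, and the surplus scalar is removed by `of_inv_mul_eq_central_mul`.
  let c := (algebraMap R (FractionRing R) r)⁻¹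
  have hc : z c * z (algebraMap R _ r) = 1 := by
    rw [← map_mul, inv_mul_cancel₀ (hK hr), map_one]
  let θ' : P.carrier →+ FractionAlgebra R Γ := e.toAddMonoidHom.comp θ
  let ψ' : Q.carrier →+ FractionAlgebra R Γ :=
    (AddMonoidHom.mulLeft (z c)).comp (e.toAddMonoidHom.comp ψ)
  have hθe (p) : θ' p = e (θ p) := rfl
  have hψe (q) : ψ' q = z c * e (ψ q) := rfl
  obtain ⟨I, hI, hIl, hIr⟩ := exists_submodule_eq_range (e := e) (φ := θ')
    (fun s p => by rw [hθe, hθl, map_mul, hθe]) (fun s p => by rw [hθe, hθr, map_mul, hθe])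
  obtain ⟨J, hJ, hJl, hJr⟩ := exists_submodule_eq_range (e := e) (φ := ψ')
    (fun s p => by rw [hψe, hψl, map_mul, hψe, ← mul_assoc, hz, mul_assoc])
    (fun s p => by rw [hψe, hψr, map_mul, hψe, mul_assoc])
  have hθψ (p q) : θ' p * ψ' q = e (f (BalancedTensor.tmul Γ p q)) := by
    rw [hθe, hψe, ← mul_assoc, ← hz, mul_assoc, ← map_mul, h1, map_mul, hez, ← mul_assoc, hc,
      one_mul]
  have hψθ (p q) : ψ' q * θ' p =
      z (c * algebraMap R _ r') * e (g (BalancedTensor.tmul Γ q p)) := by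
    rw [hθe, hψe, mul_assoc, ← map_mul, h2, map_mul e, hez, ← mul_assoc, ← map_mul]
  refine ⟨θ', I, J, ⟨?_, fun s p => ?_, fun s p => ?_⟩, hI,
    .of_inv_mul_eq_central_mul hIl hIr hJl hJr (le_antisymm ?_ ?_)
    (U := Submodule.span R {z (c * algebraMap R _ r')})
    (V := Submodule.span R {z (c * algebraMap R _ r')⁻¹}) (le_antisymm ?_ ?_)
    (order_mul_order _) (span_singleton_central fun x => hz _ x) ?_⟩
  · rw [injective_iff_map_eq_zero]
    intro p hp
    have hp : θ p = 0 := by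
      apply one_tmul_injective htf
      rw [TensorProduct.tmul_zero]
      exact hp
    apply eq_zero_of_forall_tmul_right hg0
    intro q
    apply f.injective
    rw [map_zero]
    refine (htf r (f (BalancedTensor.tmul Γ p q)) ?_).resolve_left hr
    rw [Algebra.smul_def]
    refine (h1 p q).symm.trans ?_
    rw [hp, zero_mul]
  · rw [hθe, hθl, map_mul]
    rfl
  · rw [hθe, hθr, map_mul]
    rfl
  · rw [Submodule.mul_le]
    intro a ha b hb
    obtain ⟨p, rfl⟩ := hI.ge ha
    obtain ⟨q, rfl⟩ := hJ.ge hb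
    exact ⟨_, (hθψ p q).symm⟩
  · rintro _ ⟨γ, rfl⟩
    have h3 (t : (P.tensor Q).carrier) : e (f t) ∈ I * J := by
      induction t using BalancedTensor.induction_on with
      | zero =>
        rw [map_zero]
        exact (map_zero e).symm ▸ zero_mem (I * J)
      | tmul p q =>
        rw [← hθψ]
        exact Submodule.mul_mem_mul (hI.le (Set.mem_range_self p)) (hJ.le (Set.mem_range_self q))
      | add t t' ht ht' =>
        rw [map_add]
        exact (map_add e (f t : Γ) (f t')).symm ▸ add_mem ht ht'
    have := h3 (f.symm γ)
    rwa [f.apply_symm_apply] at this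
  · rw [Submodule.mul_le]
    intro b hb a ha
    obtain ⟨p, rfl⟩ := hI.ge ha
    obtain ⟨q, rfl⟩ := hJ.ge hb
    rw [hψθ]
    exact Submodule.mul_mem_mul (Submodule.mem_span_singleton_self _) ⟨_, rfl⟩
  · intro b hb
    obtain ⟨_, ⟨γ, rfl⟩, rfl⟩ := Submodule.mem_span_singleton_mul.1 hb
    have h3 (t : (Q.tensor P).carrier) : z (c * algebraMap R _ r') * e (g t) ∈ J * I := by
      induction t using BalancedTensor.induction_on with
      | zero =>
        rw [map_zero]
        have : z (c * algebraMap R _ r') * e 0 = 0 := by rw [map_zero, mul_zero]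
        exact this.symm ▸ zero_mem (J * I)
      | tmul q p =>
        rw [← hψθ]
        exact Submodule.mul_mem_mul (hJ.le (Set.mem_range_self q)) (hI.le (Set.mem_range_self p))
      | add t t' ht ht' =>
        rw [map_add]
        have : z (c * algebraMap R _ r') * e ((g t : Γ) + g t') =
          z (c * algebraMap R _ r') * e (g t) + z (c * algebraMap R _ r') * e (g t') := by
          rw [map_add, mul_add]
        exact this.symm ▸ add_mem ht ht'
    have := h3 (g.symm γ)
    rwa [g.apply_symm_apply] at this
  · rw [Submodule.span_mul_span, Set.singleton_mul_singleton, ← map_mul,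
      mul_inv_cancel₀ (mul_ne_zero (inv_ne_zero (hK hr)) (hK hr')), map_one, Submodule.one_eq_span]

end Bimodule

/-! ### Principal invertible ideals -/

section Normalizing

variable {O A : Type*} [CommRing O] [Ring A] [Algebra O A] {G : Subalgebra O A}

local notation "E" => Subalgebra.toSubmodule G

/-- From L' a = E comes b a = 1, and one-sided inverses are two-sided here. As L E = L, each a g
lies in L = E a, so `a` conjugates the order into itself; the same holds for `b` and `L'`. -/
theorem IsInversePair.exists_unit_eq [IsDedekindFiniteMonoid A] {L L' : Submodule O A}
    (h : IsInversePair E L L') {a : A} (ha : L = E * Submodule.span O {a}) :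
    ∃ u : Aˣ, (u : A) = a ∧ (∀ g ∈ G, (u : A) * g * ↑u⁻¹ ∈ G) ∧
      ∀ g ∈ G, (↑u⁻¹ : A) * g * u ∈ G := by
  have h1 : L' * Submodule.span O {a} = E := by
    rw [← h.mul_right', mul_assoc, ← ha, h.inv_mul]
  obtain ⟨b, hb, hba⟩ := Submodule.mem_mul_span_singleton.1 (h1.ge G.one_mem)
  have hab : a * b = 1 := mul_eq_one_comm.1 hba
  have h2 : L' = E * Submodule.span O {b} := by
    rw [← h1, mul_assoc, Submodule.span_mul_span, Set.singleton_mul_singleton, hab,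
      ← Submodule.one_eq_span, mul_one]
  have key {M : Submodule O A} {x y : A} (hM : M = E * Submodule.span O {x}) (hME : M * E = M)
      (hxy : x * y = 1) : ∀ g ∈ G, x * g * y ∈ G := by
    intro g hg
    have hx : x ∈ M := hM ▸ Submodule.mem_mul_span_singleton.2 ⟨1, G.one_mem, one_mul x⟩
    have hxg : x * g ∈ M := hME ▸ Submodule.mul_mem_mul hx hg
    rw [hM] at hxg
    obtain ⟨g', hg', e⟩ := Submodule.mem_mul_span_singleton.1 hxg
    rw [← e, mul_assoc, hxy, mul_one]
    exact hg'
  exact ⟨⟨a, b, hab, hba⟩, rfl, key ha h.mul_right hab, key h2 h.mul_right' hba⟩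

theorem pow_succ_eq_order_mul_span {L : Submodule O A} {a : A}
    (ha : L = E * Submodule.span O {a}) (hL : L * E = L) (m : ℕ) :
    L ^ (m + 1) = E * Submodule.span O {a ^ (m + 1)} := by
  induction m with
  | zero => rw [zero_add, pow_one, pow_one, ha]
  | succ m ih =>
    rw [pow_succ', ih, ← mul_assoc, hL, ha, mul_assoc, Submodule.span_mul_span,
      Set.singleton_mul_singleton, pow_succ' a (m + 1)]

theorem conj_pow_mem {u : Aˣ} (h : ∀ g ∈ G, (u : A) * g * ↑u⁻¹ ∈ G) (m : ℕ) :
    ∀ g ∈ G, (↑(u ^ m) : A) * g * ↑(u ^ m)⁻¹ ∈ G := by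
  induction m with
  | zero => intro g hg; simpa using hg
  | succ m ih =>
    intro g hg
    have := h _ (ih g hg)
    rw [pow_succ', mul_inv_rev, Units.val_mul, Units.val_mul]
    simpa only [mul_assoc] using this

end Normalizing

/-! ### Tame orders and the conclusion -/

section TameOrder

variable {R : Type u} [CommRing R] [IsDomain R] [IsNoetherianRing R] [IsIntegrallyClosed R]
  {Γ : Type v} [Ring Γ] [Algebra R Γ] [Algebra.IsCentral R Γ] {A₀ : Type w} [Ring A₀]
  {ι : Γ →+* A₀}

/-- An element of norm one normalizing a tame order lies in the order. -/
theorem IsTameOrder.mem_range_of_normalizing (hΓ : IsTameOrder R ι) (a : (FractionAlgebra R Γ)ˣ)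
    (h1 : ∀ g ∈ (Algebra.TensorProduct.includeRight : Γ →ₐ[R] FractionAlgebra R Γ).range,
      (a : FractionAlgebra R Γ) * g * (↑a⁻¹ : FractionAlgebra R Γ) ∈
        (Algebra.TensorProduct.includeRight : Γ →ₐ[R] FractionAlgebra R Γ).range)
    (h2 : ∀ g ∈ (Algebra.TensorProduct.includeRight : Γ →ₐ[R] FractionAlgebra R Γ).range,
      (↑a⁻¹ : FractionAlgebra R Γ) * g * (a : FractionAlgebra R Γ) ∈
        (Algebra.TensorProduct.includeRight : Γ →ₐ[R] FractionAlgebra R Γ).range)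
    (hn : Algebra.norm (FractionRing R) (a : FractionAlgebra R Γ) = 1) :
    (a : FractionAlgebra R Γ) ∈
      (Algebra.TensorProduct.includeRight : Γ →ₐ[R] FractionAlgebra R Γ).range := by
  have htf := hΓ.eq_zero_or_eq_zero_of_smul
  have := hΓ.finite
  have := hΓ.isSimpleRing_fractionAlgebra
  have := hΓ.isReflexive
  have key (b c : FractionAlgebra R Γ)
      (h : ∀ g ∈ (Algebra.TensorProduct.includeRight : Γ →ₐ[R] FractionAlgebra R Γ).range,
        b * g * c ∈ (Algebra.TensorProduct.includeRight : Γ →ₐ[R] FractionAlgebra R Γ).range)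
      (γ : Γ) : ∃ γ' : Γ, b * 1 ⊗ₜ γ * c = 1 ⊗ₜ γ' := by
    obtain ⟨γ', h'⟩ := h _ ⟨γ, rfl⟩
    exact ⟨γ', h'.symm⟩
  obtain ⟨γ, hγ⟩ := exists_eq_one_tmul_of_forall_mem_localOrder (a : FractionAlgebra R Γ)
    fun p _ hp => mem_localOrder_of_normalizing p htf hp (hΓ.hereditary p hp) a (key _ _ h1)
      (key _ _ h2) hn
  exact ⟨γ, hγ.symm⟩

end TameOrder

theorem lemma3p6 (k : Type*) [Field k] [IsAlgClosed k] [CharZero k]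
    (R : Type u) [CommRing R] [IsDomain R] [IsNoetherianRing R] [IsIntegrallyClosed R]
    [Algebra k R] [IsLocalRing R]
    (Γ : Type v) [Ring Γ] [Algebra R Γ] [Algebra.IsCentral R Γ]
    (A : Type w) [Ring A] (ι : Γ →+* A) (hΓ : IsTameOrder R ι)
    (P : Bimodule Γ) (hPinv : P.IsInvertible) (hPcentral : P.IsCentralOver R) :
    ∃ n : ℕ, 0 < n ∧ (P.tensorPow n).Isomorphic (Bimodule.regular Γ) := by
  have htf := hΓ.eq_zero_or_eq_zero_of_smul
  have := hΓ.finite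
  have := hΓ.isSimpleRing_fractionAlgebra
  have : IsArtinianRing (FractionAlgebra R Γ) := IsArtinianRing.of_finite (FractionRing R) _
  let e : Γ →ₐ[R] FractionAlgebra R Γ := Algebra.TensorProduct.includeRight
  have he : Function.Injective e := fun γ γ' h => one_tmul_injective htf h
  have hfg : (Subalgebra.toSubmodule e.range).FG :=
    Module.Finite.iff_fg.1 (Module.Finite.range e.toLinearMap)
  obtain ⟨θ, I, J, hθ, hI, hIJ⟩ :=
    Bimodule.exists_isEmbedding_isInversePair hΓ.toIsPrimeOrder hPinv hPcentral
  obtain ⟨n, a, ha⟩ := exists_pow_eq_order_mul_span hfg hIJ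
  obtain ⟨u, rfl, hu1, hu2⟩ := (hIJ.pow n).exists_unit_eq ha
  -- The dimension d = m + 1 is the exponent for which a scalar c has norm c^d.
  obtain ⟨m, hm⟩ : ∃ m, Module.finrank (FractionRing R) (FractionAlgebra R Γ) = m + 1 :=
    Nat.exists_eq_succ_of_ne_zero Module.finrank_pos.ne'
  let δ : (FractionRing R)ˣ := Units.map (Algebra.norm (FractionRing R)) u
  let z : (FractionAlgebra R Γ)ˣ := Units.map
    (algebraMap (FractionRing R) (FractionAlgebra R Γ)).toMonoidHom δ
  have hz (x : FractionAlgebra R Γ) : (z : FractionAlgebra R Γ) * x = x * z :=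
    Algebra.commutes (δ : FractionRing R) x
  -- The scalar `z` is N(u), so N(z) = N(u)^d = N(u^d) and `w` has norm one.
  let w := u ^ (m + 1) * z⁻¹
  have hn : Algebra.norm (FractionRing R) (w : FractionAlgebra R Γ) = 1 := by
    have hz : Units.map (Algebra.norm (FractionRing R)) z = δ ^ (m + 1) := by
      ext
      exact (Algebra.norm_algebraMap (S := FractionAlgebra R Γ) (δ : FractionRing R)).trans
        (by rw [hm]; rfl)
    have : Units.map (Algebra.norm (FractionRing R)) w = 1 := by
      rw [map_mul, map_pow, map_inv, hz]
      exact mul_inv_cancel _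
    exact congrArg Units.val this
  have hz' (x : FractionAlgebra R Γ) : (↑z⁻¹ : FractionAlgebra R Γ) * x * z = x := by
    rw [mul_assoc, ← hz, Units.inv_mul_cancel_left]
  have hwc (x : FractionAlgebra R Γ) : (w : FractionAlgebra R Γ) * x * ↑w⁻¹ =
      ↑(u ^ (m + 1)) * x * ↑(u ^ (m + 1))⁻¹ := by
    rw [mul_inv_rev, inv_inv, Units.val_mul, Units.val_mul, mul_assoc, mul_assoc, ← mul_assoc x,
      ← mul_assoc (↑z⁻¹ : FractionAlgebra R Γ), ← mul_assoc (↑z⁻¹ : FractionAlgebra R Γ), hz',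
      mul_assoc]
  have hwc' (x : FractionAlgebra R Γ) : (↑w⁻¹ : FractionAlgebra R Γ) * x * w =
      ↑(u⁻¹ ^ (m + 1)) * x * ↑(u⁻¹ ^ (m + 1))⁻¹ := by
    rw [inv_pow, inv_inv, mul_inv_rev, inv_inv, Units.val_mul, Units.val_mul,
      mul_assoc (z : FractionAlgebra R Γ), hz, ← mul_assoc, mul_assoc _ (z : FractionAlgebra R Γ),
      hz, mul_assoc, mul_assoc, mul_assoc, Units.mul_inv, mul_one, mul_assoc]
  have hw1 : ∀ g ∈ e.range, (w : FractionAlgebra R Γ) * g * ↑w⁻¹ ∈ e.range := fun g hg => by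
    rw [hwc]
    exact conj_pow_mem hu1 _ g hg
  have hw2 : ∀ g ∈ e.range, (↑w⁻¹ : FractionAlgebra R Γ) * g * w ∈ e.range := fun g hg => by
    rw [hwc']
    exact conj_pow_mem (u := u⁻¹) (by rwa [inv_inv]) _ g hg
  have hw : (w : FractionAlgebra R Γ) ∈ e.range := hΓ.mem_range_of_normalizing w hw1 hw2 hn
  have hw' : (↑w⁻¹ : FractionAlgebra R Γ) ∈ e.range := by
    refine hΓ.mem_range_of_normalizing w⁻¹ (by rwa [inv_inv]) (by rwa [inv_inv]) ?_
    have := congrArg (Algebra.norm (FractionRing R)) (Units.mul_inv w)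
    rwa [map_mul, hn, one_mul, map_one] at this
  have huw : u ^ (m + 1) = w * z := by rw [inv_mul_cancel_right]
  obtain ⟨α, hα, hr⟩ := hθ.tensorPow he hI hIJ ((n + 1) * (m + 1))
  refine ⟨(n + 1) * (m + 1), Nat.mul_pos n.succ_pos m.succ_pos,
    hα.isomorphic (Bimodule.isEmbedding_regular he z.isUnit hz) ?_⟩
  -- The image of the tensor power is Γu^d = Γwz. Since `w` and its inverse lie in `Γ`, this is Γz,
  -- the image of the regular bimodule scaled by `z`.
  rw [hr, pow_mul, pow_succ_eq_order_mul_span ha (hIJ.pow n).mul_right, ← mul_assoc,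
    order_mul_order, ← Units.val_pow_eq_pow_val, huw]
  ext x
  constructor
  · intro hx
    obtain ⟨g, hg, rfl⟩ := Submodule.mem_mul_span_singleton.1 hx
    obtain ⟨γ, hγ⟩ := e.range.mul_mem hg hw
    refine ⟨γ, ?_⟩
    rw [Units.val_mul, ← mul_assoc, ← hγ]
    rfl
  · rintro ⟨γ, rfl⟩
    refine Submodule.mem_mul_span_singleton.2 ⟨e γ * ↑w⁻¹, e.range.mul_mem ⟨γ, rfl⟩ hw', ?_⟩
    rw [Units.val_mul, ← mul_assoc, Units.inv_mul_cancel_right]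
    rfl
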